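/- Cutting and stacking. Let $r_n \ge 2$ ($n \ge 0$) be integers (the cutting parameters) and let $s_n(i) \ge 0$ ($n\ge 0$, $0\le i\le r_n-1$) be integers (the spacer parameters). A column is a finite sequence of pairwise disjoint left-closed, right-open intervals of equal length in $\mathbb R$, called its levels, ordered from bottom to top; it defines a partial transformation that translates each level except the top one onto the next level. Let $C_0$ consist of a single interval $B_0$ of positive length. Given $C_n$, cut each of its levels into $r_n$ subintervals of equal length, numbered $0,\dots,r_n-1$ from left to right; for each $i$ form the $i$-th subcolumn from the $i$-th subintervals of the levels of $C_n$ with $s_n(i)$ new disjoint intervals (spacers) of the same length placed on top; and let $C_{n+1}$ be obtained by stacking these subcolumns in the order $i=0,\dots,r_n-1$, the later ones above the earlier ones. The partial transformation of $C_{n+1}$ extends that of $C_n$, and in the limit one obtains an a.e. defined, a.e. invertible measure-preserving transformation of the union of all levels of all columns with Lebesgue measure. A measure-preserving transformation $T$ of a measure space $(X,\mu)$ is called rank-one with parameters $(r_n),(s_n)$ if it is isomorphic, modulo null sets, to the transformation so constructed. Partial boundedness. If $s_n(r_n-1)=0$ for all $n$, define words over $\{0,1\}$ by $w_0=0$ and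 $$w_{n+1}=w_n1^{s_n(0)}w_n1^{s_n(1)}\cdots w_n1^{s_n(r_n-2)}w_n ,$$ and let $|w_n|$ denote the length of $w_n$. A rank-one transformation $T$ is called partially bounded if it is rank-one with some parameters $(r_n),(s_n)$ such that $s_n(r_n-1)=0$ for all $n\ge 0$ and such that there are integers $\mathfrak R>0$, $\mathfrak S>0$ and $N$ with, for all $n\ge N$, 1. $r_n<\mathfrak R$; 2. $|s_n(i)-s_n(j)|<\mathfrak S$ for $0\le i,j<r_n-1$; 3. $s_n(i)\ge |w_n|$ for $0\le i<r_n-1$. Theorem. Let $T$ be a partially bounded rank-one transformation of $(X,\mu)$. Then every measure-preserving transformation $S$ of $(X,\mu)$ (invertible or not) with $S\circ T=T\circ S$ a.e. is a power of $T$: there is $k\in\mathbb Z$ with $S=T^k$ a.e. In particular $T$ has trivial centralizer: the set $C(T)$ of all a.e. invertible measure-preserving transformations of $(X,\mu)$ that commute with $T$ a.e. is, up to a.e. equality, $\{T^k : k\in\mathbb Z\}$. -/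

import Mathlib

open MeasureTheory

noncomputable section

/-- Cutting parameters `r n ≥ 2` and spacer parameters `s n i` of a cutting and stacking
construction. Only the values `s n i` with `i < r n` are used. -/
structure RankOneParams where
  /-- the number of subcolumns into which the `n`-th column is cut -/
  r : ℕ → ℕ
  /-- the number of spacers placed above the `i`-th subcolumn of the `n`-th column -/
  s : ℕ → ℕ → ℕ
  two_le_r : ∀ n, 2 ≤ r n

namespace RankOneParams

variable (P : RankOneParams)

/-! ### Cutting and stacking, with base interval `[0, ℓ)` -/

/-- The common length of the levels of the `n`-th column. -/
def width (ℓ : ℝ) : ℕ → ℝ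
  | 0 => ℓ
  | n + 1 => width ℓ n / P.r n

/-- The levels of the `n`-th column tile `[0, front n)`; new spacers are taken from `front n` on. -/
def front (ℓ : ℝ) : ℕ → ℝ
  | 0 => ℓ
  | n + 1 => front ℓ n + (∑ i ∈ Finset.range (P.r n), (P.s n i : ℝ)) * P.width ℓ (n + 1)

/-- The `n`-th column: the list, from bottom to top, of the left endpoints of its levels.
Each level is cut into `r n` subintervals of equal length. The `i`-th subcolumn consists of the
`i`-th subintervals (from the left) of the levels, with `s n i` new intervals on top of them, and
the subcolumns are stacked, right above left. -/
def column (ℓ : ℝ) : ℕ → List ℝ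
  | 0 => [0]
  | n + 1 => (List.range (P.r n)).flatMap fun (i : ℕ) =>
      (column ℓ n).map (fun a => a + (i : ℝ) * P.width ℓ (n + 1)) ++
      (List.range (P.s n i)).map (fun (k : ℕ) =>
        P.front ℓ n + ((∑ j ∈ Finset.range i, (P.s n j : ℝ)) + (k : ℝ)) * P.width ℓ (n + 1))

/-- The level of the `n`-th column with left endpoint `a`. -/
def level (ℓ : ℝ) (n : ℕ) (a : ℝ) : Set ℝ := Set.Ico a (a + P.width ℓ n)

/-- The space: the union of all the levels of all the columns. -/
def space (ℓ : ℝ) : Set ℝ := ⋃ (n : ℕ) (a ∈ P.column ℓ n), P.level ℓ n a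

/-- Lebesgue measure on the space. -/
def measure (ℓ : ℝ) : Measure ℝ := volume.restrict (P.space ℓ)

/-- The partial transformation defined by the `n`-th column sends `x` to `y`: the point `x` lies in
a level other than the top one, and `y` is its image under the translation of this level onto the
next one. -/
def Sends (ℓ : ℝ) (n : ℕ) (x y : ℝ) : Prop :=
  ∃ (j : ℕ) (hj : j + 1 < (P.column ℓ n).length),
    x ∈ P.level ℓ n (P.column ℓ n)[j] ∧ y = x - (P.column ℓ n)[j] + (P.column ℓ n)[j + 1]

open Classical in
/-- The rank-one transformation: the common extension of the partial transformations defined by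
the columns (each of them extends the previous one). Points at which none of these is defined are
fixed; inside the space they form a null set. -/
def transformation (ℓ : ℝ) (x : ℝ) : ℝ :=
  if h : ∃ y, ∃ n, P.Sends ℓ n x y then h.choose else x

/-! ### Rank-one words and partial boundedness -/

/-- The rank-one words: `w₀ = 0`, `wₙ₊₁ = wₙ 1^{sₙ(0)} wₙ 1^{sₙ(1)} ⋯ 1^{sₙ(rₙ-2)} wₙ`. -/
def word : ℕ → List (Fin 2)
  | 0 => [0]
  | n + 1 => ((List.range (P.r n - 1)).flatMap fun (i : ℕ) => word n ++ List.replicate (P.s n i) 1)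
      ++ word n

/-- Partially bounded parameters: no spacers on the final subcolumn at any stage and, from some
stage on, bounded cuts, spacer numbers within a stage differing by less than a constant, and
spacer numbers at least the length of the rank-one word. -/
def PartiallyBounded : Prop :=
  (∀ n, P.s n (P.r n - 1) = 0) ∧
  ∃ R S N : ℕ, 0 < R ∧ 0 < S ∧ ∀ n, N ≤ n →
    P.r n < R ∧
    (∀ i j, i < P.r n - 1 → j < P.r n - 1 → |(P.s n i : ℤ) - (P.s n j : ℤ)| < (S : ℤ)) ∧
    (∀ i, i < P.r n - 1 → (P.word n).length ≤ P.s n i)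

end RankOneParams

/-- Isomorphism (modulo null sets) of measure-preserving systems. -/
def SystemIsomorphic {X Y : Type*} [MeasurableSpace X] [MeasurableSpace Y]
    (μ : Measure X) (T : X → X) (ν : Measure Y) (U : Y → Y) : Prop :=
  ∃ (φ : X → Y) (ψ : Y → X), MeasurePreserving φ μ ν ∧ MeasurePreserving ψ ν μ ∧
    ψ ∘ φ =ᵐ[μ] id ∧ φ ∘ ψ =ᵐ[ν] id ∧ φ ∘ T =ᵐ[μ] U ∘ φ

/-- `T` is a partially bounded rank-one transformation of `(X, μ)`: a measure-preserving
transformation that is presented by cutting and stacking, starting from an interval of some length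
`ℓ > 0`, with partially bounded parameters. -/
def IsPartiallyBoundedRankOne {X : Type*} [MeasurableSpace X] (μ : Measure X) (T : X → X) : Prop :=
  MeasurePreserving T μ μ ∧
  ∃ (ℓ : ℝ) (P : RankOneParams), 0 < ℓ ∧ P.PartiallyBounded ∧
    SystemIsomorphic μ T (P.measure ℓ) (P.transformation ℓ)

/-- `S` is a measure-preserving transformation that is invertible modulo null sets. -/
def IsInvertibleMeasurePreserving {X : Type*} [MeasurableSpace X] (μ : Measure X) (S : X → X) :
    Prop :=
  MeasurePreserving S μ μ ∧
    ∃ R : X → X, MeasurePreserving R μ μ ∧ R ∘ S =ᵐ[μ] id ∧ S ∘ R =ᵐ[μ] id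

/-- `S = T ^ k` almost everywhere for some integer `k`; for `k = -m ≤ 0` this means that `S` is
almost everywhere the inverse of `T ^ m`. -/
def IsPowerAE {X : Type*} [MeasurableSpace X] (μ : Measure X) (T S : X → X) : Prop :=
  (∃ m : ℕ, S =ᵐ[μ] T^[m]) ∨ (∃ m : ℕ, T^[m] ∘ S =ᵐ[μ] id ∧ S ∘ T^[m] =ᵐ[μ] id)

/-- The centralizer of `T`: all invertible measure-preserving transformations that commute with `T`
almost everywhere. -/
def transformationCentralizer {X : Type*} [MeasurableSpace X] (μ : Measure X) (T : X → X) :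
    Set (X → X) :=
  {S | IsInvertibleMeasurePreserving μ S ∧ S ∘ T =ᵐ[μ] T ∘ S}

/-- The centralizer of `T` consists exactly of the integer powers of `T` (more precisely, of the
measurable maps that agree almost everywhere with an integer power of `T`). -/
def HasTrivialCentralizer {X : Type*} [MeasurableSpace X] (μ : Measure X) (T : X → X) : Prop :=
  transformationCentralizer μ T = {S | Measurable S ∧ IsPowerAE μ T S}

end

/-! The orbits of `x` and `S x` are compared through their visits to the bases of the columns. Write
`Cₘ` for the `m`-th column and `hₘ` for its height. The set of points that `S` sends into the
interval `B₀` has finite positive measure, so by Lebesgue density it nearly fills some level of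
every late column; commutation carries the resulting estimate to all levels. Hence, during most
passages of `x` through `Cₘ`, the point `S x` also passes through `Cₘ`, displaced by some `d` with
`|d| < hₘ`. Invertibility of `S` plays no role here.

Cuts and spacers improve this bound (`abs_lt_of_near`). Fix a late stage `n` and let `m ≥ n`. By
Markov's inequality, for at least half of the base of `Cₙ`, the current passage of `x` through `Cₘ`
has such a displacement, and a proportion less than `1/R` of the visits to the base of `Cₙ` inside
it have no close visit of `S x`. Each of the fewer than `R` copies of `Cₘ₋₁` in the passage then
contains a good visit. If `|d| ≥ hₘ₋₁`, the first or the last copy would lie outside the passage of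
`S x` through `Cₘ`, inside a gap of length at least `hₘ`: a contradiction. So `|d| < hₘ₋₁`, and the
argument repeats inside a copy with few bad visits, down to `|d| < hₙ`.

This bound does not depend on `m`. With positive measure some `d` therefore recurs for infinitely
many `m`; `S x` moved by `d` steps shares levels of arbitrarily small width with `x`, so it equals
`x`. The set where this happens is invariant, and ergodicity (`ae_mem_of_invariant`) makes it
conull. -/

noncomputable section
namespace RankOneParams

variable (P : RankOneParams)

/-! ### Heights of columns and positions of subcolumns -/

/-- The number of levels of the `n`-th column. -/
def height : ℕ → ℕ
  | 0 => 1
  | n + 1 => ∑ i ∈ Finset.range (P.r n), (height n + P.s n i)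

/-- The index in the `(n+1)`-st column of the lowest level of the `i`-th subcolumn. -/
def base (n i : ℕ) : ℕ := ∑ j ∈ Finset.range i, (P.height n + P.s n j)

lemma height_succ (n : ℕ) : P.height (n + 1) = P.base n (P.r n) := rfl

@[simp] lemma base_zero (n : ℕ) : P.base n 0 = 0 := by simp [base]

lemma base_succ (n i : ℕ) : P.base n (i + 1) = P.base n i + P.height n + P.s n i := by
  simp [base, Finset.sum_range_succ, add_assoc]

lemma base_mono (n : ℕ) : Monotone (P.base n) :=
  monotone_nat_of_le_succ fun i => by rw [base_succ]; omega

lemma base_add_height_le_of_lt {n i j : ℕ} (h : i < j) :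
    P.base n i + P.height n + P.s n i ≤ P.base n j := by
  rw [← base_succ]; exact P.base_mono n h

lemma base_add_height_le {n i : ℕ} (h : i < P.r n) :
    P.base n i + P.height n ≤ P.height (n + 1) := by
  have := P.base_add_height_le_of_lt (n := n) h
  rw [height_succ]; omega

lemma height_pos (n : ℕ) : 0 < P.height n := by
  induction n with
  | zero => simp [height]
  | succ n ih =>
    have := P.base_add_height_le (n := n) (i := 0) (by have := P.two_le_r n; omega)
    omega

lemma height_le_succ (n : ℕ) : P.height n ≤ P.height (n + 1) := by
  have := P.base_add_height_le (n := n) (i := 0) (by have := P.two_le_r n; omega)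
  omega

lemma height_mono : Monotone P.height := monotone_nat_of_le_succ P.height_le_succ

lemma base_inj {n i j k l : ℕ} (hk : k < P.height n) (hl : l < P.height n)
    (h : P.base n i + k = P.base n j + l) : i = j := by
  rcases lt_trichotomy i j with hij | hij | hij
  · have := P.base_add_height_le_of_lt (n := n) hij; omega
  · exact hij
  · have := P.base_add_height_le_of_lt (n := n) hij; omega

/-- The case split behind all inductions on the stage: a level of the next column is a piece of an
old level or a spacer. -/
lemma exists_base_add {n p m : ℕ} (h : p < P.base n m) :
    ∃ i < m, (∃ k < P.height n, p = P.base n i + k) ∨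
      ∃ k < P.s n i, p = P.base n i + P.height n + k := by
  induction m with
  | zero => simp at h
  | succ m ih =>
    rcases lt_or_ge p (P.base n m) with h' | h'
    · obtain ⟨i, hi, h''⟩ := ih h'
      exact ⟨i, by omega, h''⟩
    · rw [base_succ] at h
      refine ⟨m, by omega, ?_⟩
      rcases lt_or_ge p (P.base n m + P.height n) with h'' | h''
      · exact .inl ⟨p - P.base n m, by omega, by omega⟩
      · exact .inr ⟨p - P.base n m - P.height n, by omega, by omega⟩

/-- The length of the rank-one word is the height of the column, if no spacers are put on top. -/
lemma length_word (hs : ∀ n, P.s n (P.r n - 1) = 0) (n : ℕ) :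
    (P.word n).length = P.height n := by
  induction n with
  | zero => simp [word, height]
  | succ n ih =>
    have h2 := P.two_le_r n
    have h : P.r n = (P.r n - 1) + 1 := by omega
    rw [height_succ, h, base_succ, hs, word]
    have key : ∀ m, (((List.range m).flatMap fun (i : ℕ) =>
        P.word n ++ List.replicate (P.s n i) (1 : Fin 2))).length = P.base n m := by
      intro m
      induction m with
      | zero => simp
      | succ m ihm =>
        rw [List.range_succ, List.flatMap_append, List.length_append, ihm, base_succ]
        simp [ih, add_assoc]
    simp only [List.length_append, key, ih, add_zero]

/-! ### Levels of columns -/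

variable {ℓ : ℝ}

lemma width_pos (hℓ : 0 < ℓ) (n : ℕ) : 0 < P.width ℓ n := by
  induction n with
  | zero => simpa [width]
  | succ n ih =>
    have := P.two_le_r n
    rw [width]
    have : (0 : ℝ) < P.r n := by exact_mod_cast (by omega : 0 < P.r n)
    positivity

lemma r_mul_width (n : ℕ) : (P.r n : ℝ) * P.width ℓ (n + 1) = P.width ℓ n := by
  have := P.two_le_r n
  have : (P.r n : ℝ) ≠ 0 := by exact_mod_cast (by omega : P.r n ≠ 0)
  rw [width]; field_simp

lemma width_le (hℓ : 0 < ℓ) (n : ℕ) : P.width ℓ n ≤ ℓ * (1 / 2) ^ n := by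
  induction n with
  | zero => simp [width]
  | succ n ih =>
    have h2 : (2 : ℝ) ≤ P.r n := by exact_mod_cast P.two_le_r n
    have h := P.r_mul_width (ℓ := ℓ) n
    have hp := P.width_pos hℓ (n + 1)
    have : 2 * P.width ℓ (n + 1) ≤ P.width ℓ n := by rw [← h]; gcongr
    rw [pow_succ]; linarith

lemma tendsto_width (hℓ : 0 < ℓ) : Filter.Tendsto (P.width ℓ) Filter.atTop (nhds 0) := by
  refine squeeze_zero (fun n => (P.width_pos hℓ n).le) (P.width_le hℓ) ?_
  simpa using (tendsto_pow_atTop_nhds_zero_of_lt_one (r := (1 / 2 : ℝ))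
    (by norm_num) (by norm_num)).const_mul ℓ

lemma front_le_succ (hℓ : 0 < ℓ) (n : ℕ) : P.front ℓ n ≤ P.front ℓ (n + 1) := by
  rw [front]
  have := P.width_pos hℓ (n + 1)
  have h0 : (0 : ℝ) ≤ ∑ i ∈ Finset.range (P.r n), (P.s n i : ℝ) := by positivity
  nlinarith [mul_nonneg h0 this.le]

lemma getElem?_flatMap_range {α : Type*} (g : ℕ → List α) {m i k : ℕ} (hi : i < m)
    (hk : k < (g i).length) :
    ((List.range m).flatMap g)[(∑ j ∈ Finset.range i, (g j).length) + k]? = (g i)[k]? := by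
  have hlen : ∀ m, ((List.range m).flatMap g).length = ∑ j ∈ Finset.range m, (g j).length := by
    intro m
    induction m with
    | zero => simp
    | succ m ih => rw [List.range_succ, List.flatMap_append, List.length_append, ih,
        Finset.sum_range_succ]; simp
  induction m with
  | zero => omega
  | succ m ih =>
    rw [List.range_succ, List.flatMap_append]
    rcases Nat.lt_succ_iff_lt_or_eq.mp hi with h | rfl
    · rw [List.getElem?_append_left, ih h]
      rw [hlen]
      calc _ < (∑ j ∈ Finset.range i, (g j).length) + (g i).length := by omega
        _ = ∑ j ∈ Finset.range (i + 1), (g j).length := (Finset.sum_range_succ _ _).symm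
        _ ≤ _ := Finset.sum_le_sum_of_subset (by simpa using h)
    · rw [List.getElem?_append_right (by rw [hlen]; omega), hlen]
      simp

lemma length_column (n : ℕ) : (P.column ℓ n).length = P.height n := by
  induction n with
  | zero => simp [column, height]
  | succ n ih =>
    rw [column, height, List.length_flatMap, ← ih]
    simp only [List.length_append, List.length_map, List.length_range]
    induction P.r n with
    | zero => simp
    | succ m ihm => simp [List.range_succ, Finset.sum_range_succ, ihm]

lemma column_succ_base {n i k : ℕ} (hi : i < P.r n) (hk : k < P.height n) :
    (P.column ℓ (n + 1))[P.base n i + k]? =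
      (P.column ℓ n)[k]?.map fun a => a + (i : ℝ) * P.width ℓ (n + 1) := by
  have := getElem?_flatMap_range (fun (i : ℕ) =>
      (P.column ℓ n).map (fun a => a + (i : ℝ) * P.width ℓ (n + 1)) ++
      (List.range (P.s n i)).map (fun (k : ℕ) =>
        P.front ℓ n + ((∑ j ∈ Finset.range i, (P.s n j : ℝ)) + (k : ℝ)) * P.width ℓ (n + 1)))
      (k := k) hi (by simp [length_column]; omega)
  simp only [List.length_append, List.length_map, List.length_range, length_column] at this
  rw [column, base, this, List.getElem?_append_left (by simpa [length_column]), List.getElem?_map]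

lemma column_succ_spacer {n i k : ℕ} (hi : i < P.r n) (hk : k < P.s n i) :
    (P.column ℓ (n + 1))[P.base n i + P.height n + k]? = some
      (P.front ℓ n + ((∑ j ∈ Finset.range i, (P.s n j : ℝ)) + (k : ℝ)) * P.width ℓ (n + 1)) := by
  have := getElem?_flatMap_range (fun (i : ℕ) =>
      (P.column ℓ n).map (fun a => a + (i : ℝ) * P.width ℓ (n + 1)) ++
      (List.range (P.s n i)).map (fun (k : ℕ) =>
        P.front ℓ n + ((∑ j ∈ Finset.range i, (P.s n j : ℝ)) + (k : ℝ)) * P.width ℓ (n + 1)))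
      (k := P.height n + k) hi (by simp [length_column]; omega)
  simp only [List.length_append, List.length_map, List.length_range, length_column] at this
  rw [column, base, add_assoc, this, List.getElem?_append_right (by simp [length_column])]
  simp [length_column, hk]

variable (ℓ) in
/-- The `i`-th level, from the bottom, of the `n`-th column; empty if there is no such level. -/
def lev (n i : ℕ) : Set ℝ := {x | ∃ a, (P.column ℓ n)[i]? = some a ∧ x ∈ P.level ℓ n a}

lemma exists_column {n i : ℕ} (hi : i < P.height n) : ∃ a, (P.column ℓ n)[i]? = some a :=
  ⟨_, List.getElem?_eq_getElem (by rwa [length_column])⟩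

lemma lev_eq {n i : ℕ} {a : ℝ} (h : (P.column ℓ n)[i]? = some a) :
    P.lev ℓ n i = Set.Ico a (a + P.width ℓ n) := by
  ext x; simp [lev, h, level]

lemma lt_height_of_mem {n i : ℕ} {x : ℝ} (h : x ∈ P.lev ℓ n i) : i < P.height n := by
  obtain ⟨a, ha, -⟩ := h
  rw [← P.length_column (ℓ := ℓ)]
  exact (List.getElem?_eq_some_iff.mp ha).1

lemma exists_lev_eq_Ico {n i : ℕ} (hi : i < P.height n) :
    ∃ a, P.lev ℓ n i = Set.Ico a (a + P.width ℓ n) := by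
  obtain ⟨a, ha⟩ := P.exists_column (ℓ := ℓ) hi
  exact ⟨a, P.lev_eq ha⟩

lemma measurableSet_lev (n i : ℕ) : MeasurableSet (P.lev ℓ n i) := by
  by_cases hi : i < P.height n
  · obtain ⟨a, ha⟩ := P.exists_lev_eq_Ico (ℓ := ℓ) hi
    rw [ha]; exact measurableSet_Ico
  · convert MeasurableSet.empty
    exact Set.eq_empty_of_forall_notMem fun x hx => hi (P.lt_height_of_mem hx)

lemma space_eq : P.space ℓ = ⋃ (n : ℕ) (i : ℕ), P.lev ℓ n i := by
  ext x
  simp only [space, Set.mem_iUnion, lev, Set.mem_ofPred_eq]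
  constructor
  · rintro ⟨n, a, ha, hx⟩
    obtain ⟨i, hi⟩ := List.mem_iff_getElem?.mp ha
    exact ⟨n, i, a, hi, hx⟩
  · rintro ⟨n, i, a, hi, hx⟩
    exact ⟨n, a, List.mem_iff_getElem?.mpr ⟨i, hi⟩, hx⟩

lemma mem_space {x : ℝ} : x ∈ P.space ℓ ↔ ∃ n i, x ∈ P.lev ℓ n i := by
  simp [space_eq]

lemma lev_subset_space (n i : ℕ) : P.lev ℓ n i ⊆ P.space ℓ :=
  fun _ hx => P.mem_space.mpr ⟨n, i, hx⟩

lemma measurableSet_space : MeasurableSet (P.space ℓ) := by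
  rw [space_eq]
  exact .iUnion fun n => .iUnion fun i => P.measurableSet_lev n i

lemma measure_lev {n i : ℕ} (hi : i < P.height n) :
    P.measure ℓ (P.lev ℓ n i) = ENNReal.ofReal (P.width ℓ n) := by
  rw [measure, Measure.restrict_apply' P.measurableSet_space,
    Set.inter_eq_left.mpr (P.lev_subset_space n i)]
  obtain ⟨a, ha⟩ := P.exists_lev_eq_Ico (ℓ := ℓ) hi
  rw [ha, Real.volume_Ico]; simp

/-- A level of the `n`-th column is cut into levels of the `(n+1)`-st column. -/
lemma lev_succ_eq {n i k : ℕ} {a : ℝ} (hi : i < P.r n) (ha : (P.column ℓ n)[k]? = some a) :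
    P.lev ℓ (n + 1) (P.base n i + k) = Set.Ico (a + i * P.width ℓ (n + 1))
      (a + i * P.width ℓ (n + 1) + P.width ℓ (n + 1)) := by
  have hk : k < P.height n := by
    rw [← P.length_column (ℓ := ℓ)]; exact (List.getElem?_eq_some_iff.mp ha).1
  exact P.lev_eq (by rw [P.column_succ_base hi hk, ha]; rfl)

lemma lev_succ_subset (hℓ : 0 < ℓ) {n i k : ℕ} (hi : i < P.r n) (hk : k < P.height n) :
    P.lev ℓ (n + 1) (P.base n i + k) ⊆ P.lev ℓ n k := by
  obtain ⟨a, ha⟩ := P.exists_column (ℓ := ℓ) hk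
  rw [P.lev_succ_eq hi ha, P.lev_eq ha]
  have hw := P.width_pos hℓ (n + 1)
  have hr : (i : ℝ) + 1 ≤ P.r n := by exact_mod_cast hi
  refine Set.Ico_subset_Ico (by have : (0 : ℝ) ≤ i := by positivity
                                nlinarith) ?_
  rw [← P.r_mul_width (ℓ := ℓ) n]; nlinarith

lemma exists_mem_lev_succ (hℓ : 0 < ℓ) {n k : ℕ} {x : ℝ} (hx : x ∈ P.lev ℓ n k) :
    ∃ i < P.r n, x ∈ P.lev ℓ (n + 1) (P.base n i + k) := by
  obtain ⟨a, ha, hxa⟩ := hx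
  have hw := P.width_pos hℓ (n + 1)
  rw [level, ← P.r_mul_width] at hxa
  have h0 : 0 ≤ (x - a) / P.width ℓ (n + 1) := div_nonneg (by linarith [hxa.1]) hw.le
  have h1 := Nat.floor_le h0
  have h2 := Nat.lt_floor_add_one ((x - a) / P.width ℓ (n + 1))
  rw [le_div_iff₀ hw] at h1
  rw [div_lt_iff₀ hw] at h2
  have h3 : ⌊(x - a) / P.width ℓ (n + 1)⌋₊ < P.r n := by
    rw [Nat.floor_lt h0, div_lt_iff₀ hw]; linarith [hxa.2]
  refine ⟨_, h3, ?_⟩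
  rw [P.lev_succ_eq h3 ha]
  constructor <;> nlinarith

/-- Together with `front_le_of_mem_spacer`, this keeps new spacers disjoint from all old levels. -/
lemma lev_subset_Ico (hℓ : 0 < ℓ) (n i : ℕ) : P.lev ℓ n i ⊆ Set.Ico 0 (P.front ℓ n) := by
  induction n generalizing i with
  | zero =>
    rintro x ⟨a, ha, hx⟩
    have : a = 0 := by
      rcases i with _ | i <;> simp [column] at ha; exact ha.symm
    subst this
    simpa [level, front, width] using hx
  | succ n ih =>
    intro x hx
    have hi := P.lt_height_of_mem hx
    rw [height_succ] at hi
    obtain ⟨j, hj, ⟨k, hk, rfl⟩ | ⟨k, hk, rfl⟩⟩ := P.exists_base_add hi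
    · exact Set.Ico_subset_Ico_right (P.front_le_succ hℓ n) (ih k (P.lev_succ_subset hℓ hj hk hx))
    · rw [P.lev_eq (P.column_succ_spacer hj hk)] at hx
      have hw := P.width_pos hℓ (n + 1)
      have hf : 0 ≤ P.front ℓ n := by
        obtain ⟨a, ha⟩ := P.exists_lev_eq_Ico (ℓ := ℓ) (P.height_pos n)
        have hm : a ∈ P.lev ℓ n 0 := by rw [ha]; simp [P.width_pos hℓ n]
        exact ((ih 0 hm).1.trans_lt (ih 0 hm).2).le
      have h0 : (0 : ℝ) ≤ ∑ j ∈ Finset.range j, (P.s n j : ℝ) := by positivity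
      have hk' : (k : ℝ) + 1 ≤ P.s n j := by exact_mod_cast hk
      have hsum : (∑ j ∈ Finset.range j, (P.s n j : ℝ)) + P.s n j ≤
          ∑ i ∈ Finset.range (P.r n), (P.s n i : ℝ) := by
        rw [← Finset.sum_range_succ]
        exact Finset.sum_le_sum_of_subset_of_nonneg (by simpa using hj) (by intros; positivity)
      constructor
      · refine le_trans ?_ hx.1; positivity
      · refine hx.2.trans_le ?_
        rw [front]
        nlinarith

lemma front_le_of_mem_spacer (hℓ : 0 < ℓ) {n i k : ℕ} {x : ℝ} (hi : i < P.r n) (hk : k < P.s n i)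
    (hx : x ∈ P.lev ℓ (n + 1) (P.base n i + P.height n + k)) : P.front ℓ n ≤ x := by
  rw [P.lev_eq (P.column_succ_spacer hi hk)] at hx
  have hw := P.width_pos hℓ (n + 1)
  refine le_trans ?_ hx.1
  have : (0 : ℝ) ≤ ∑ j ∈ Finset.range i, (P.s n j : ℝ) := by positivity
  have : 0 ≤ ((∑ j ∈ Finset.range i, (P.s n j : ℝ)) + (k : ℝ)) * P.width ℓ (n + 1) := by positivity
  linarith

lemma nat_eq_of_mem_Ico {w a b x : ℝ} (hw : 0 < w) {k k' : ℕ}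
    (h : x ∈ Set.Ico (a + k * w) (a + k * w + w)) (hb : a = b)
    (h' : x ∈ Set.Ico (b + k' * w) (b + k' * w + w)) : k = k' := by
  subst hb
  have h1 : (k : ℝ) < k' + 1 := by nlinarith [h.1, h'.2]
  have h2 : (k' : ℝ) < k + 1 := by nlinarith [h.2, h'.1]
  have h1 : k < k' + 1 := by exact_mod_cast h1
  have h2 : k' < k + 1 := by exact_mod_cast h2
  omega

/-- The levels of a column are pairwise disjoint. -/
lemma lev_index_unique (hℓ : 0 < ℓ) {n i j : ℕ} {x : ℝ} (hi : x ∈ P.lev ℓ n i)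
    (hj : x ∈ P.lev ℓ n j) : i = j := by
  induction n generalizing i j with
  | zero =>
    have := P.lt_height_of_mem hi
    have := P.lt_height_of_mem hj
    simp only [height] at *
    omega
  | succ n ih =>
    have hw := P.width_pos hℓ (n + 1)
    have hi' := P.lt_height_of_mem hi
    have hj' := P.lt_height_of_mem hj
    rw [height_succ] at hi' hj'
    obtain ⟨p, hp, ⟨k, hk, rfl⟩ | ⟨k, hk, rfl⟩⟩ := P.exists_base_add hi' <;>
    obtain ⟨p', hp', ⟨k', hk', rfl⟩ | ⟨k', hk', rfl⟩⟩ := P.exists_base_add hj'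
    · obtain rfl := ih (P.lev_succ_subset hℓ hp hk hi) (P.lev_succ_subset hℓ hp' hk' hj)
      obtain ⟨a, ha⟩ := P.exists_column (ℓ := ℓ) hk
      rw [P.lev_succ_eq hp ha] at hi
      rw [P.lev_succ_eq hp' ha] at hj
      rw [nat_eq_of_mem_Ico hw hi rfl hj]
    · have h1 := P.front_le_of_mem_spacer hℓ hp' hk' hj
      have h2 := (P.lev_subset_Ico hℓ n k (P.lev_succ_subset hℓ hp hk hi)).2
      linarith
    · have h1 := P.front_le_of_mem_spacer hℓ hp hk hi
      have h2 := (P.lev_subset_Ico hℓ n k' (P.lev_succ_subset hℓ hp' hk' hj)).2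
      linarith
    · rw [P.lev_eq (P.column_succ_spacer hp hk)] at hi
      rw [P.lev_eq (P.column_succ_spacer hp' hk')] at hj
      have key : (∑ j ∈ Finset.range p, P.s n j) + k = (∑ j ∈ Finset.range p', P.s n j) + k' :=
        nat_eq_of_mem_Ico hw (a := P.front ℓ n) (x := x) (by push_cast; exact hi) rfl
          (by push_cast; exact hj)
      have aux : ∀ {p p' : ℕ}, p < p' →
          (∑ j ∈ Finset.range p, P.s n j) + P.s n p ≤ ∑ j ∈ Finset.range p', P.s n j := by
        intro p p' h
        rw [← Finset.sum_range_succ]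
        exact Finset.sum_le_sum_of_subset (by simpa using h)
      rcases lt_trichotomy p p' with h | rfl | h
      · have := aux h; omega
      · omega
      · have := aux h; omega

/-! ### The transformation on the levels -/

lemma sends_iff {n : ℕ} {x y : ℝ} : P.Sends ℓ n x y ↔ ∃ (j : ℕ) (a b : ℝ),
    (P.column ℓ n)[j]? = some a ∧ (P.column ℓ n)[j + 1]? = some b ∧ x ∈ P.level ℓ n a ∧
      y = x - a + b := by
  constructor
  · rintro ⟨j, hj, hx, hy⟩
    exact ⟨j, _, _, List.getElem?_eq_getElem (by omega), List.getElem?_eq_getElem hj, hx, hy⟩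
  · rintro ⟨j, a, b, ha, hb, hx, hy⟩
    obtain ⟨h1, rfl⟩ := List.getElem?_eq_some_iff.mp ha
    obtain ⟨h2, rfl⟩ := List.getElem?_eq_some_iff.mp hb
    exact ⟨j, h2, hx, hy⟩

lemma Sends.succ {P : RankOneParams} (hℓ : 0 < ℓ) {n : ℕ} {x y : ℝ} (h : P.Sends ℓ n x y) :
    P.Sends ℓ (n + 1) x y := by
  rw [sends_iff] at h
  obtain ⟨j, a, b, ha, hb, hx, rfl⟩ := h
  obtain ⟨i, hi, hxi⟩ := P.exists_mem_lev_succ hℓ (n := n) (k := j) ⟨a, ha, hx⟩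
  have hb' : j + 1 < P.height n := by
    rw [← P.length_column (ℓ := ℓ)]; exact (List.getElem?_eq_some_iff.mp hb).1
  rw [P.lev_succ_eq hi ha] at hxi
  rw [sends_iff]
  refine ⟨P.base n i + j, a + i * P.width ℓ (n + 1), b + i * P.width ℓ (n + 1), ?_, ?_, hxi, ?_⟩
  · rw [P.column_succ_base hi (by omega), ha]; rfl
  · rw [add_assoc, P.column_succ_base hi hb', hb]; rfl
  · ring

lemma Sends.mono {P : RankOneParams} (hℓ : 0 < ℓ) {n m : ℕ} (hnm : n ≤ m) {x y : ℝ}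
    (h : P.Sends ℓ n x y) : P.Sends ℓ m x y := by
  induction m, hnm using Nat.le_induction with
  | base => exact h
  | succ m _ ih => exact ih.succ hℓ

/-- Later columns extend earlier ones, so both values can be read in one column. This makes the
choice in `transformation` harmless. -/
lemma Sends.unique {P : RankOneParams} (hℓ : 0 < ℓ) {n m : ℕ} {x y z : ℝ} (h : P.Sends ℓ n x y)
    (h' : P.Sends ℓ m x z) : y = z := by
  replace h := h.mono hℓ (le_max_left n m)
  replace h' := h'.mono hℓ (le_max_right n m)
  rw [sends_iff] at h h'
  obtain ⟨j, a, b, ha, hb, hx, rfl⟩ := h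
  obtain ⟨j', a', b', ha', hb', hx', rfl⟩ := h'
  obtain rfl := P.lev_index_unique hℓ ⟨a, ha, hx⟩ ⟨a', ha', hx'⟩
  rw [ha] at ha'; rw [hb] at hb'
  cases ha'; cases hb'; rfl

/-- The transformation translates every level but the top one onto the next one. -/
lemma exists_transformation_eq_add (hℓ : 0 < ℓ) {n i : ℕ} (hi : i + 1 < P.height n) :
    ∃ c : ℝ, (∀ x ∈ P.lev ℓ n i, P.transformation ℓ x = x + c) ∧
      ∀ x, x + c ∈ P.lev ℓ n (i + 1) ↔ x ∈ P.lev ℓ n i := by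
  obtain ⟨a, ha⟩ := P.exists_column (ℓ := ℓ) (show i < P.height n by omega)
  obtain ⟨b, hb⟩ := P.exists_column (ℓ := ℓ) hi
  refine ⟨b - a, fun x hx => ?_, fun x => ?_⟩
  · have hs : P.Sends ℓ n x (x - a + b) := by
      rw [sends_iff]
      exact ⟨i, a, b, ha, hb, by rwa [P.lev_eq ha] at hx, rfl⟩
    have h : ∃ y, ∃ n, P.Sends ℓ n x y := ⟨_, n, hs⟩
    rw [transformation, dif_pos h]
    obtain ⟨m, hm⟩ := h.choose_spec
    rw [hm.unique hℓ hs]; ring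
  · rw [P.lev_eq ha, P.lev_eq hb, Set.mem_Ico, Set.mem_Ico]
    constructor <;> rintro ⟨h1, h2⟩ <;> constructor <;> linarith

lemma transformation_mem_lev (hℓ : 0 < ℓ) {n i : ℕ} (hi : i + 1 < P.height n) {x : ℝ}
    (hx : x ∈ P.lev ℓ n i) : P.transformation ℓ x ∈ P.lev ℓ n (i + 1) := by
  obtain ⟨c, h1, h2⟩ := P.exists_transformation_eq_add hℓ hi
  rw [h1 x hx, h2]; exact hx

end RankOneParams
end

noncomputable section
namespace RankOneParams

variable (P : RankOneParams)

/-! ### Occurrences of a column in a later column -/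

/-- The indices of those levels of the `m`-th column that are part of the base of the `n`-th
column, for `n ≤ m`. -/
def occ (n : ℕ) : ℕ → Finset ℕ
  | 0 => if n = 0 then {0} else ∅
  | m + 1 => if n = m + 1 then {0} else
      (Finset.range (P.r m)).biUnion fun i => (occ n m).image fun q => P.base m i + q

@[simp] lemma occ_self (n : ℕ) : P.occ n n = {0} := by
  cases n <;> simp [occ]

lemma occ_succ {n m : ℕ} (h : n ≤ m) : P.occ n (m + 1) =
    (Finset.range (P.r m)).biUnion fun i => (P.occ n m).image fun q => P.base m i + q := by
  rw [occ, if_neg (by omega)]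

lemma mem_occ_succ {n m p : ℕ} (h : n ≤ m) :
    p ∈ P.occ n (m + 1) ↔ ∃ i < P.r m, ∃ q ∈ P.occ n m, p = P.base m i + q := by
  simp [P.occ_succ h, eq_comm]

lemma le_of_mem_occ {n m q : ℕ} (h : q ∈ P.occ n m) : n ≤ m := by
  induction m generalizing q with
  | zero =>
    by_contra hn
    rw [occ, if_neg (by omega)] at h
    simp at h
  | succ m ih =>
    by_cases hn : n = m + 1
    · omega
    · rw [occ, if_neg hn] at h
      simp only [Finset.mem_biUnion, Finset.mem_image] at h
      obtain ⟨i, -, q, hq, -⟩ := h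
      have := ih hq
      omega

lemma occ_add_height_le {n m q : ℕ} (h : q ∈ P.occ n m) : q + P.height n ≤ P.height m := by
  have hnm := P.le_of_mem_occ h
  induction m, hnm using Nat.le_induction generalizing q with
  | base => simp at h; omega
  | succ m hnm ih =>
    obtain ⟨i, hi, q, hq, rfl⟩ := (P.mem_occ_succ hnm).mp h
    have := P.base_add_height_le hi
    have := ih hq
    omega

lemma lt_height_of_mem_occ {n m q : ℕ} (h : q ∈ P.occ n m) : q < P.height m := by
  have := P.occ_add_height_le h
  have := P.height_pos n
  omega

lemma zero_mem_occ {n m : ℕ} (h : n ≤ m) : 0 ∈ P.occ n m := by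
  induction m, h using Nat.le_induction with
  | base => simp
  | succ m hnm ih =>
    exact (P.mem_occ_succ hnm).mpr ⟨0, by have := P.two_le_r m; omega, 0, ih, by simp⟩

lemma sum_occ_succ {M : Type*} [AddCommMonoid M] {n m : ℕ} (h : n ≤ m) (f : ℕ → M) :
    ∑ p ∈ P.occ n (m + 1), f p =
      ∑ i ∈ Finset.range (P.r m), ∑ q ∈ P.occ n m, f (P.base m i + q) := by
  rw [P.occ_succ h, Finset.sum_biUnion]
  · refine Finset.sum_congr rfl fun i _ => ?_
    rw [Finset.sum_image fun a _ b _ hab => by simpa using hab]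
  · intro i _ j _ hij
    rw [Function.onFun, Finset.disjoint_left]
    intro p hp hp'
    simp only [Finset.mem_image] at hp hp'
    obtain ⟨q, hq, rfl⟩ := hp
    obtain ⟨q', hq', h'⟩ := hp'
    exact hij (P.base_inj (P.lt_height_of_mem_occ hq) (P.lt_height_of_mem_occ hq') h'.symm)

lemma card_occ_succ {n m : ℕ} (h : n ≤ m) :
    (P.occ n (m + 1)).card = P.r m * (P.occ n m).card := by
  rw [Finset.card_eq_sum_ones, P.sum_occ_succ h]; simp

/-- The definition of `occ` splits off the last stage; here the earliest one is split off instead,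
which locates a copy of a column inside its parent copy. -/
lemma mem_occ_iff_of_lt {n m q : ℕ} (h : n < m) :
    q ∈ P.occ n m ↔ ∃ i < P.r n, ∃ q' ∈ P.occ (n + 1) m, q = q' + P.base n i := by
  induction m, h using Nat.le_induction generalizing q with
  | base => simp [P.mem_occ_succ le_rfl]
  | succ m hnm ih =>
    have hnm : n + 1 ≤ m := hnm
    rw [P.mem_occ_succ (by omega : n ≤ m)]
    constructor
    · rintro ⟨j, hj, p, hp, rfl⟩
      obtain ⟨i, hi, q', hq', rfl⟩ := ih.mp hp
      exact ⟨i, hi, _, (P.mem_occ_succ hnm).mpr ⟨j, hj, q', hq', rfl⟩, by omega⟩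
    · rintro ⟨i, hi, q', hq', rfl⟩
      obtain ⟨j, hj, p, hp, rfl⟩ := (P.mem_occ_succ hnm).mp hq'
      exact ⟨j, hj, _, ih.mpr ⟨i, hi, p, hp, rfl⟩, by omega⟩

/-! ### Visits to the base of a column -/

variable {ℓ : ℝ}

variable (ℓ) in
/-- The time `e`, positive or negative, is a visit of (the orbit of) `x` to the base of the `n`-th
column. -/
def Visits (n : ℕ) (x : ℝ) (e : ℤ) : Prop :=
  ∃ m p, x ∈ P.lev ℓ m p ∧ ∃ q ∈ P.occ n m, (p : ℤ) + e = q

/-- Here `t` is the bottom index of the copy of the `m`-th column that contains `x`, so that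
relative positions do not depend on the column used to read them. -/
lemma exists_visits_lift (hℓ : 0 < ℓ) {m k p : ℕ} {x : ℝ} (hx : x ∈ P.lev ℓ m p) (hmk : m ≤ k) :
    ∃ t p', x ∈ P.lev ℓ k p' ∧ p' = t + p ∧ t + P.height m ≤ P.height k ∧
      ∀ n q, q ∈ P.occ n m → t + q ∈ P.occ n k := by
  induction k, hmk using Nat.le_induction with
  | base => exact ⟨0, p, hx, by simp⟩
  | succ k hmk ih =>
    obtain ⟨t, p', hx', rfl, ht, h⟩ := ih
    obtain ⟨i, hi, hxi⟩ := P.exists_mem_lev_succ hℓ hx'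
    refine ⟨P.base k i + t, _, hxi, by omega, ?_, fun n q hq => ?_⟩
    · have := P.base_add_height_le hi; omega
    · refine (P.mem_occ_succ ((P.le_of_mem_occ hq).trans hmk)).mpr ⟨i, hi, _, h n q hq, by omega⟩

lemma Visits.lift {P : RankOneParams} (hℓ : 0 < ℓ) {n : ℕ} {x : ℝ} {e : ℤ} (h : P.Visits ℓ n x e) :
    ∃ m₀, ∀ m, m₀ ≤ m → ∃ p, x ∈ P.lev ℓ m p ∧ ∃ q ∈ P.occ n m, (p : ℤ) + e = q := by
  obtain ⟨m₀, p, hx, q, hq, he⟩ := h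
  refine ⟨m₀, fun m hm => ?_⟩
  obtain ⟨t, p', hx', rfl, -, h⟩ := P.exists_visits_lift hℓ hx hm
  exact ⟨_, hx', _, h n q hq, by push_cast; omega⟩

lemma visits_neg_of_mem_lev {n i : ℕ} {x : ℝ} (h : x ∈ P.lev ℓ n i) : P.Visits ℓ n x (-i) :=
  ⟨n, i, h, 0, by simp, by simp⟩

lemma lev_add_occ_subset (hℓ : 0 < ℓ) {n m q i : ℕ} (hq : q ∈ P.occ n m) (hi : i < P.height n) :
    P.lev ℓ m (q + i) ⊆ P.lev ℓ n i := by
  have hnm := P.le_of_mem_occ hq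
  induction m, hnm using Nat.le_induction generalizing q with
  | base => simp at hq; simp [hq]
  | succ m hnm ih =>
    obtain ⟨j, hj, q, hq₁, rfl⟩ := (P.mem_occ_succ hnm).mp hq
    have := P.occ_add_height_le hq₁
    rw [add_assoc]
    exact (P.lev_succ_subset hℓ hj (by omega)).trans (ih hq₁)

lemma mem_lev_of_visits_neg (hℓ : 0 < ℓ) {n i : ℕ} {x : ℝ} (hi : i < P.height n)
    (h : P.Visits ℓ n x (-i)) : x ∈ P.lev ℓ n i := by
  obtain ⟨m, p, hx, q, hq, he⟩ := h
  obtain rfl : p = q + i := by omega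
  exact P.lev_add_occ_subset hℓ hq hi hx

lemma Visits.succ_of {P : RankOneParams} {n i : ℕ} {x : ℝ} {e : ℤ} (hi : i < P.r n)
    (h : P.Visits ℓ (n + 1) x e) : P.Visits ℓ n x (e + P.base n i) := by
  obtain ⟨m, p, hx, q, hq, he⟩ := h
  exact ⟨m, p, hx, q + P.base n i,
    (P.mem_occ_iff_of_lt (P.le_of_mem_occ hq)).mpr ⟨i, hi, q, hq, rfl⟩, by push_cast; omega⟩

/-- Every copy of an early column sits inside a copy of each later one. -/
lemma Visits.exists_ancestor {P : RankOneParams} (hℓ : 0 < ℓ) {n m : ℕ} (hnm : n ≤ m) {x : ℝ}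
    {e : ℤ} (h : P.Visits ℓ n x e) :
    ∃ e', P.Visits ℓ m x e' ∧ e' ≤ e ∧ e + P.height n ≤ e' + P.height m := by
  induction m, hnm using Nat.le_induction with
  | base => exact ⟨e, h, by simp⟩
  | succ m hnm ih =>
    obtain ⟨e', he', h1, h2⟩ := ih
    obtain ⟨k, hk⟩ := he'.lift hℓ
    -- The column used must be at least the `(m+1)`-st, for the copy of the `m`-th column to have a
    -- parent there.
    obtain ⟨p, hx, q, hq, he⟩ := hk (max k (m + 1)) (le_max_left _ _)
    obtain ⟨i, hi, q', hq', rfl⟩ := (P.mem_occ_iff_of_lt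
      (lt_of_lt_of_le (Nat.lt_succ_self m) (le_max_right _ _))).mp hq
    have := P.base_add_height_le hi
    exact ⟨q' - p, ⟨_, p, hx, q', hq', by omega⟩, by omega, by omega⟩

/-! ### Separation of passages by wide gaps -/

/-- From the stage `N` on, the numbers of cuts are less than `R`, and spacer numbers inside the
column are at least its height; there are no spacers on top. -/
structure WideGaps (N R : ℕ) : Prop where
  top : ∀ n, P.s n (P.r n - 1) = 0
  cuts : ∀ n, N ≤ n → P.r n < R
  gaps : ∀ n, N ≤ n → ∀ i < P.r n - 1, P.height n ≤ P.s n i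

variable {P} {N R : ℕ}

lemma WideGaps.height_succ (hP : P.WideGaps N R) (n : ℕ) :
    P.height (n + 1) = P.base n (P.r n - 1) + P.height n := by
  have h2 := P.two_le_r n
  have h : P.r n = (P.r n - 1) + 1 := by omega
  rw [P.height_succ]
  conv_lhs => rw [h]
  rw [base_succ, hP.top, add_zero]

lemma WideGaps.base_add_le (hP : P.WideGaps N R) {n i j : ℕ} (hn : N ≤ n) (hij : i < j)
    (hj : j < P.r n) : P.base n i + 2 * P.height n ≤ P.base n j := by
  have := P.base_add_height_le_of_lt (n := n) hij
  have := hP.gaps n hn i (by omega)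
  omega

/-- Between consecutive copies lies the spacer block of some stage `k ≥ n`, whose length is at least
the height of the `k`-th column and so of the `n`-th. -/
lemma WideGaps.occ_separated (hP : P.WideGaps N R) {n m q q' : ℕ} (hn : N ≤ n)
    (hq : q ∈ P.occ n m) (hq' : q' ∈ P.occ n m) (h : q < q') : q + 2 * P.height n ≤ q' := by
  have hnm := P.le_of_mem_occ hq
  induction m, hnm using Nat.le_induction generalizing q q' with
  | base => simp at hq hq'; omega
  | succ m hnm ih =>
    obtain ⟨i, hi, q, hq₁, rfl⟩ := (P.mem_occ_succ hnm).mp hq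
    obtain ⟨i', hi', q', hq₂, rfl⟩ := (P.mem_occ_succ hnm).mp hq'
    have h1 := P.occ_add_height_le hq₁
    have h2 := P.occ_add_height_le hq₂
    have h3 := P.height_mono hnm
    rcases lt_trichotomy i i' with hi'' | rfl | hi''
    · have := hP.base_add_le (hn.trans hnm) hi'' hi'; omega
    · have := ih hq₁ hq₂ (by omega); omega
    · have := hP.base_add_le (hn.trans hnm) hi'' hi; omega

lemma WideGaps.visits_separated (hP : P.WideGaps N R) (hℓ : 0 < ℓ) {n : ℕ} (hn : N ≤ n) {x : ℝ}
    {e e' : ℤ} (he : P.Visits ℓ n x e) (he' : P.Visits ℓ n x e') (h : e < e') :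
    e + 2 * P.height n ≤ e' := by
  obtain ⟨m, hm⟩ := he.lift hℓ
  obtain ⟨m', hm'⟩ := he'.lift hℓ
  obtain ⟨p, hx, q, hq, hpq⟩ := hm (max m m') (le_max_left _ _)
  obtain ⟨p', hx', q', hq', hpq'⟩ := hm' (max m m') (le_max_right _ _)
  obtain rfl := P.lev_index_unique hℓ hx hx'
  have := hP.occ_separated hn hq hq' (by omega)
  omega

/-- A visit to the base of the `n`-th column takes place inside a given passage through the `m`-th
column, or well before it, or well after it. -/
lemma WideGaps.visits_cases (hP : P.WideGaps N R) (hℓ : 0 < ℓ) {n m : ℕ} (hm : N ≤ m)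
    (hnm : n ≤ m) {x : ℝ} {e f : ℤ} (he : P.Visits ℓ m x e) (hf : P.Visits ℓ n x f) :
    f + P.height n + P.height m ≤ e ∨ e + 2 * P.height m ≤ f ∨
      e ≤ f ∧ f + P.height n ≤ e + P.height m := by
  obtain ⟨e', he', h1, h2⟩ := hf.exists_ancestor hℓ hnm
  rcases lt_trichotomy e e' with h | rfl | h
  · have := hP.visits_separated hℓ hm he he' h; omega
  · omega
  · have := hP.visits_separated hℓ hm he' he h; omega

/-! ### Displacement between passages of two orbits -/

variable (P ℓ) in
/-- The time `e` is a visit of `x` to the base of the `n`-th column, and `y` has such a visit at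
some time whose distance from `e` is less than the height of this column. -/
def Near (n : ℕ) (x y : ℝ) (e : ℤ) : Prop :=
  P.Visits ℓ n x e ∧ ∃ d : ℤ, |d| < P.height n ∧ P.Visits ℓ n y (e + d)

/-- If `d ≥ P.height m`, the first copy of the `m`-th column in the passage of `x` is over before
the passage of `y` begins; if `d ≤ -P.height m`, the last copy begins after that passage has ended.
The copy then falls in a gap of `y`, too far from any other passage for a near visit. -/
lemma WideGaps.abs_lt_of_near_first_last (hP : P.WideGaps N R) (hℓ : 0 < ℓ) {n m : ℕ} (hm : N ≤ m)
    (hnm : n ≤ m) {x y : ℝ} {e d : ℤ} (hd : |d| < P.height (m + 1))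
    (hy : P.Visits ℓ (m + 1) y (e + d))
    (hfirst : ∃ q ∈ P.occ n m, P.Near ℓ n x y (e + q))
    (hlast : ∃ q ∈ P.occ n m, P.Near ℓ n x y (e + P.base m (P.r m - 1) + q)) :
    |d| < P.height m := by
  have hh := hP.height_succ m
  obtain ⟨q, hq, -, d₁, hd₁, h₁⟩ := hfirst
  obtain ⟨q', hq', -, d₂, hd₂, h₂⟩ := hlast
  have c₁ := hP.visits_cases hℓ (by omega) (by omega : n ≤ m + 1) hy h₁
  have c₂ := hP.visits_cases hℓ (by omega) (by omega : n ≤ m + 1) hy h₂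
  have b := P.occ_add_height_le hq
  have b' := P.occ_add_height_le hq'
  rw [abs_lt] at *
  constructor
  · by_contra hc
    omega
  · by_contra hc
    omega

open Classical in
/-- If most visits of `x` to the base of the `n`-th column during a passage through the `m`-th
column are close to visits of `y`, then the passages of `x` and `y` through the `m`-th column
are separated by less than the height of the `n`-th column. -/
lemma WideGaps.abs_lt_of_near (hP : P.WideGaps N R) (hℓ : 0 < ℓ) {n m : ℕ} (hn : N ≤ n)
    (hnm : n ≤ m) {x y : ℝ} {e d : ℤ} (hd : |d| < P.height m)
    (hx : P.Visits ℓ m x e) (hy : P.Visits ℓ m y (e + d))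
    (hc : ((P.occ n m).filter fun q : ℕ => ¬ P.Near ℓ n x y (e + q)).card * R <
      (P.occ n m).card) : |d| < P.height n := by
  induction m, hnm using Nat.le_induction generalizing e with
  | base => exact hd
  | succ m hnm ih =>
    have h2 := P.two_le_r m
    have hR := hP.cuts m (hn.trans hnm)
    set f : ℕ → ℕ := fun i => ((P.occ n m).filter
      fun q : ℕ => ¬ P.Near ℓ n x y (e + P.base m i + q)).card with hf
    have hsum : ((P.occ n (m + 1)).filter fun q : ℕ => ¬ P.Near ℓ n x y (e + q)).card =
        ∑ i ∈ Finset.range (P.r m), f i := by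
      simp only [hf, Finset.card_filter, P.sum_occ_succ hnm]
      push_cast
      simp only [add_assoc]
    rw [hsum, P.card_occ_succ hnm] at hc
    -- A copy with only bad visits would account for a proportion `1 / P.r m > 1 / R` of all visits.
    have hex : ∀ i < P.r m, ∃ q ∈ P.occ n m, P.Near ℓ n x y (e + P.base m i + q) := by
      intro i hi
      by_contra! hall
      have : f i = (P.occ n m).card := by
        rw [hf]; exact congrArg _ (Finset.filter_true_of_mem hall)
      have h1 : f i ≤ ∑ i ∈ Finset.range (P.r m), f i :=
        Finset.single_le_sum (fun _ _ => Nat.zero_le _) (Finset.mem_range.mpr hi)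
      have h3 : P.r m * (P.occ n m).card ≤ R * f i := by rw [this]; gcongr
      have : f i * R ≤ (∑ i ∈ Finset.range (P.r m), f i) * R := by gcongr
      linarith
    have hd' : |d| < P.height m := by
      refine hP.abs_lt_of_near_first_last hℓ (hn.trans hnm) hnm hd hy ?_ (hex _ (by omega))
      simpa using hex 0 (by omega)
    -- By averaging, some copy inherits the bound on the proportion of bad visits; the induction
    -- continues in it.
    obtain ⟨i, hi, hfi⟩ : ∃ i < P.r m, f i * R < (P.occ n m).card := by
      by_contra! hall
      have : ∑ i ∈ Finset.range (P.r m), (P.occ n m).card ≤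
          ∑ i ∈ Finset.range (P.r m), f i * R :=
        Finset.sum_le_sum fun i hi => hall i (Finset.mem_range.mp hi)
      rw [← Finset.sum_mul] at this
      simp at this
      omega
    refine ih (e := e + P.base m i) hd' (hx.succ_of hi) ?_ hfi
    have := hy.succ_of hi
    rwa [add_right_comm] at this

/-! ### Shifting visits along orbits -/

variable (P ℓ) in
/-- The first `k` steps of the orbit of `x` are defined by some column. -/
def Regular (k : ℕ) (x : ℝ) : Prop := ∃ m p, x ∈ P.lev ℓ m p ∧ p + k < P.height m

lemma Regular.lift (hℓ : 0 < ℓ) {k : ℕ} {x : ℝ} (h : P.Regular ℓ k x) :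
    ∃ m₀, ∀ m, m₀ ≤ m → ∃ p, x ∈ P.lev ℓ m p ∧ p + k < P.height m := by
  obtain ⟨m₀, p, hx, hp⟩ := h
  refine ⟨m₀, fun m hm => ?_⟩
  obtain ⟨t, p', hx', rfl, ht, -⟩ := P.exists_visits_lift hℓ hx hm
  exact ⟨_, hx', by omega⟩

/-- Regularity puts `x` below the top level of all late columns, where the transformation is a move
up by one level. -/
lemma Regular.visits_transformation (hℓ : 0 < ℓ) {x : ℝ} (h : P.Regular ℓ 1 x) (n : ℕ) (e : ℤ) :
    P.Visits ℓ n (P.transformation ℓ x) e ↔ P.Visits ℓ n x (e + 1) := by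
  obtain ⟨m₀, hm₀⟩ := h.lift hℓ
  constructor <;> intro hv <;> obtain ⟨m, hm⟩ := hv.lift hℓ <;>
    obtain ⟨p, hp, hpk⟩ := hm₀ _ (le_max_left m₀ m) <;>
    obtain ⟨p', hp', q, hq, he⟩ := hm _ (le_max_right m₀ m) <;>
    have ht := P.transformation_mem_lev hℓ hpk hp
  · obtain rfl := P.lev_index_unique hℓ ht hp'
    exact ⟨_, p, hp, q, hq, by push_cast at he; omega⟩
  · obtain rfl := P.lev_index_unique hℓ hp hp'
    exact ⟨_, _, ht, q, hq, by push_cast; omega⟩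

lemma Regular.transformation_injective (hℓ : 0 < ℓ) {x y : ℝ} (hx : P.Regular ℓ 1 x)
    (hy : P.Regular ℓ 1 y) (h : P.transformation ℓ x = P.transformation ℓ y) : x = y := by
  obtain ⟨m, hm⟩ := hx.lift hℓ
  obtain ⟨m', hm'⟩ := hy.lift hℓ
  obtain ⟨p, hp, hpk⟩ := hm _ (le_max_left m m')
  obtain ⟨p', hp', hpk'⟩ := hm' _ (le_max_right m m')
  have h1 := P.transformation_mem_lev hℓ hpk hp
  have h2 := P.transformation_mem_lev hℓ hpk' hp'
  rw [h] at h1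
  obtain rfl : p = p' := by simpa using P.lev_index_unique hℓ h1 h2
  obtain ⟨c, hc, -⟩ := P.exists_transformation_eq_add hℓ hpk
  rw [hc x hp, hc y hp'] at h
  linarith

/-- Two points that lie in a common level of infinitely many columns are equal. -/
lemma eq_of_frequently_mem_lev (hℓ : 0 < ℓ) {x y : ℝ}
    (h : ∃ᶠ n in Filter.atTop, ∃ i, x ∈ P.lev ℓ n i ∧ y ∈ P.lev ℓ n i) : x = y := by
  by_contra hne
  have hpos : 0 < |x - y| := abs_pos.mpr (sub_ne_zero.mpr hne)
  obtain ⟨n, ⟨i, hx, hy⟩, hn⟩ :=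
    (h.and_eventually ((P.tendsto_width hℓ).eventually (gt_mem_nhds hpos))).exists
  obtain ⟨a, ha⟩ := P.exists_lev_eq_Ico (ℓ := ℓ) (P.lt_height_of_mem hx)
  rw [ha] at hx hy
  have : |x - y| < P.width ℓ n := by
    rw [abs_lt]; constructor <;> linarith [hx.1, hx.2, hy.1, hy.2]
  linarith

end RankOneParams
end

/-! ### Measure estimates inside levels, and ergodicity -/

noncomputable section
/-- Markov's inequality for the number of members of a finite family of sets, measurable or not,
that contain a point. -/
lemma mul_measure_le_card_filter_mul {α ι : Type*} [MeasurableSpace α] (μ : Measure α)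
    (s : Finset ι) (Q : ι → Set α) (K R : ℕ) [∀ x, DecidablePred fun j => x ∈ Q j] :
    (K : ENNReal) * μ {x | K ≤ (s.filter fun j => x ∈ Q j).card * R} ≤
      R * ∑ j ∈ s, μ (Q j) := by
  let f : α → ENNReal := fun x =>
    (∑ j ∈ s, (toMeasurable μ (Q j)).indicator (fun _ => (1 : ENNReal)) x) * R
  have hf : Measurable f := (Finset.measurable_sum _ fun j _ =>
    measurable_const.indicator (measurableSet_toMeasurable _ _)).mul_const _
  calc _ ≤ (K : ENNReal) * μ {x | (K : ENNReal) ≤ f x} := by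
        gcongr with x
        intro hx
        refine (Nat.cast_le.mpr hx).trans ?_
        rw [Nat.cast_mul, Finset.card_filter]
        push_cast
        refine mul_le_mul_left (Finset.sum_le_sum fun j _ => ?_) _
        by_cases hj : x ∈ Q j
        · simp [hj, subset_toMeasurable μ (Q j) hj]
        · simp [hj]
    _ ≤ ∫⁻ x, f x ∂μ := mul_meas_ge_le_lintegral hf _
    _ = _ := by
        rw [lintegral_mul_const' _ _ (by simp), lintegral_finsetSum _ fun j _ =>
          measurable_const.indicator (measurableSet_toMeasurable _ _), mul_comm]
        simp [lintegral_indicator, measurableSet_toMeasurable]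

namespace RankOneParams

variable (P : RankOneParams) {ℓ : ℝ}

lemma measure_apply (D : Set ℝ) : P.measure ℓ D = volume (D ∩ P.space ℓ) :=
  Measure.restrict_apply' P.measurableSet_space

lemma measure_lev_inter (n i : ℕ) (D : Set ℝ) :
    P.measure ℓ (P.lev ℓ n i ∩ D) = volume (P.lev ℓ n i ∩ D) := by
  rw [measure_apply, Set.inter_eq_left.mpr]
  exact Set.inter_subset_left.trans (P.lev_subset_space n i)

lemma ae_mem_space : ∀ᵐ x ∂P.measure ℓ, x ∈ P.space ℓ :=
  ae_restrict_mem P.measurableSet_space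

lemma measure_lev_inter_succ (hℓ : 0 < ℓ) {n k : ℕ} (hk : k < P.height n) (D : Set ℝ) :
    P.measure ℓ (P.lev ℓ n k ∩ D) =
      ∑ i ∈ Finset.range (P.r n), P.measure ℓ (P.lev ℓ (n + 1) (P.base n i + k) ∩ D) := by
  have hU : P.lev ℓ n k = ⋃ i ∈ Finset.range (P.r n), P.lev ℓ (n + 1) (P.base n i + k) := by
    ext x
    simp only [Set.mem_iUnion, Finset.mem_range]
    exact ⟨fun hx => by simpa using P.exists_mem_lev_succ hℓ hx,
      fun ⟨i, hi, hx⟩ => P.lev_succ_subset hℓ hi hk hx⟩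
  simp only [← Measure.restrict_apply (P.measurableSet_lev _ _)]
  rw [hU, measure_biUnion_finset _ fun i _ => P.measurableSet_lev _ _]
  intro i _ j _ hij
  refine Set.disjoint_left.mpr fun x hx hx' => hij ?_
  exact P.base_inj hk hk (P.lev_index_unique hℓ hx hx')

lemma measure_lev_inter_eq_sum (hℓ : 0 < ℓ) {n m k : ℕ} (hnm : n ≤ m) (hk : k < P.height n)
    (D : Set ℝ) : P.measure ℓ (P.lev ℓ n k ∩ D) =
      ∑ q ∈ P.occ n m, P.measure ℓ (P.lev ℓ m (q + k) ∩ D) := by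
  induction m, hnm using Nat.le_induction with
  | base => simp
  | succ m hnm ih =>
    rw [ih, P.sum_occ_succ hnm, Finset.sum_comm]
    refine Finset.sum_congr rfl fun q hq => ?_
    have := P.occ_add_height_le hq
    rw [P.measure_lev_inter_succ hℓ (by omega)]
    simp only [add_assoc]

lemma width_eq_card_mul (hℓ : 0 < ℓ) {n m : ℕ} (hnm : n ≤ m) :
    ENNReal.ofReal (P.width ℓ n) = (P.occ n m).card * ENNReal.ofReal (P.width ℓ m) := by
  have := P.measure_lev_inter_eq_sum hℓ hnm (P.height_pos n) Set.univ
  simp only [Set.inter_univ, add_zero] at this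
  rw [P.measure_lev (P.height_pos n)] at this
  rw [this, Finset.sum_congr rfl fun q hq => P.measure_lev (P.lt_height_of_mem_occ hq)]
  simp

/-- The transformation is a translation between the two levels, so translation invariance of
Lebesgue measure suffices; `D` and `D'` need not be measurable. -/
lemma measure_lev_succ_inter (hℓ : 0 < ℓ) {n i : ℕ} (hi : i + 1 < P.height n) {D D' : Set ℝ}
    (h : ∀ᵐ x ∂P.measure ℓ, P.transformation ℓ x ∈ D ↔ x ∈ D') :
    P.measure ℓ (P.lev ℓ n (i + 1) ∩ D) = P.measure ℓ (P.lev ℓ n i ∩ D') := by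
  obtain ⟨c, hc, hc'⟩ := P.exists_transformation_eq_add hℓ hi
  have h1 : P.measure ℓ (P.lev ℓ n i ∩ D') =
      P.measure ℓ (P.lev ℓ n i ∩ P.transformation ℓ ⁻¹' D) := by
    refine measure_congr ?_
    filter_upwards [h] with x hx
    exact propext (and_congr_right fun _ => hx.symm)
  have h2 : P.lev ℓ n i ∩ P.transformation ℓ ⁻¹' D =
      (fun x => x + c) ⁻¹' (P.lev ℓ n (i + 1) ∩ D) := by
    ext x
    simp only [Set.mem_inter_iff, Set.mem_preimage, hc']
    refine and_congr_right fun hx => by rw [hc x hx]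
  rw [h1, h2, measure_lev_inter, ← measure_preimage_add_right volume c, ← h2, measure_lev_inter]

/-- A family of sets that is compatible with the transformation occupies the same part of every
level. -/
lemma measure_lev_inter_eq_base (hℓ : 0 < ℓ) {F : ℤ → Set ℝ}
    (hF : ∀ e, ∀ᵐ x ∂P.measure ℓ, P.transformation ℓ x ∈ F e ↔ x ∈ F (e + 1)) {n i : ℕ}
    (hi : i < P.height n) :
    P.measure ℓ (P.lev ℓ n i ∩ F (-i)) = P.measure ℓ (P.lev ℓ n 0 ∩ F 0) := by
  induction i with
  | zero => simp
  | succ i ih =>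
    rw [← ih (by omega), P.measure_lev_succ_inter hℓ hi (hF _)]
    congr 3
    push_cast
    ring

lemma measure_lev_inter_congr (hℓ : 0 < ℓ) {F : ℤ → Set ℝ}
    (hF : ∀ e, ∀ᵐ x ∂P.measure ℓ, P.transformation ℓ x ∈ F e ↔ x ∈ F (e + 1)) {n i j : ℕ}
    (hi : i < P.height n) (hj : j < P.height n) :
    P.measure ℓ (P.lev ℓ n i ∩ F (-i)) = P.measure ℓ (P.lev ℓ n j ∩ F (-j)) := by
  rw [P.measure_lev_inter_eq_base hℓ hF hi, P.measure_lev_inter_eq_base hℓ hF hj]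

lemma width_ne_zero (hℓ : 0 < ℓ) (n : ℕ) : ENNReal.ofReal (P.width ℓ n) ≠ 0 := by
  simpa using P.width_pos hℓ n

/-- In late columns, some level is mostly contained in a given set of positive measure. -/
lemma eventually_exists_lt_measure_lev_inter (hℓ : 0 < ℓ) {E : Set ℝ} (h0 : P.measure ℓ E ≠ 0)
    (hfin : P.measure ℓ E ≠ ⊤) {c : ENNReal} (hc : c < 1) :
    ∀ᶠ m in Filter.atTop, ∃ j < P.height m,
      c * ENNReal.ofReal (P.width ℓ m) < P.measure ℓ (P.lev ℓ m j ∩ E) := by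
  rw [measure_apply] at h0 hfin
  -- Outer regularity: `E` fills more than the proportion `c` of an open set.
  obtain ⟨O, hEO, hO, hOlt⟩ : ∃ O ⊇ E ∩ P.space ℓ, IsOpen O ∧
      c * volume O < volume (E ∩ P.space ℓ) := by
    rcases eq_or_ne c 0 with rfl | hc0
    · exact ⟨Set.univ, Set.subset_univ _, isOpen_univ, by simpa using pos_iff_ne_zero.mpr h0⟩
    · have : volume (E ∩ P.space ℓ) < volume (E ∩ P.space ℓ) / c := by
        rw [ENNReal.lt_div_iff_mul_lt (.inl hc0) (.inl hc.ne_top)]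
        calc _ < volume (E ∩ P.space ℓ) * 1 :=
              ENNReal.mul_lt_mul_right h0 hfin hc
          _ = _ := mul_one _
      obtain ⟨O, hEO, hO, hlt⟩ := Set.exists_isOpen_lt_of_lt _ _ this
      refine ⟨O, hEO, hO, ?_⟩
      rwa [ENNReal.lt_div_iff_mul_lt (.inl hc0) (.inl hc.ne_top), mul_comm] at hlt
  -- The levels inside `O` exhaust `E`, because the widths tend to zero. If each met `E` in a
  -- proportion at most `c`, the measure of `G m ∩ E` would be at most `c * volume O`.
  let G : ℕ → Set ℝ := fun m => {x | ∃ j, x ∈ P.lev ℓ m j ∧ P.lev ℓ m j ⊆ O}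
  have hG : Monotone G := by
    refine monotone_nat_of_le_succ fun m x ⟨j, hx, hj⟩ => ?_
    obtain ⟨i, hi, hxi⟩ := P.exists_mem_lev_succ hℓ hx
    exact ⟨_, hxi, (P.lev_succ_subset hℓ hi (P.lt_height_of_mem hx)).trans hj⟩
  have hun : ⋃ m, (G m ∩ (E ∩ P.space ℓ)) = E ∩ P.space ℓ := by
    rw [← Set.iUnion_inter, Set.inter_eq_right]
    intro x hx
    obtain ⟨δ, hδ, hball⟩ := Metric.isOpen_iff.mp hO x (hEO hx)
    obtain ⟨n, i, hxi⟩ := P.mem_space.mp hx.2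
    obtain ⟨m, hm, hnm⟩ := (((P.tendsto_width hℓ).eventually (gt_mem_nhds hδ)).and
      (Filter.eventually_ge_atTop n)).exists
    obtain ⟨t, p, hp, -⟩ := P.exists_visits_lift hℓ hxi hnm
    refine Set.mem_iUnion.mpr ⟨m, p, hp, fun y hy => hball ?_⟩
    obtain ⟨a, ha⟩ := P.exists_lev_eq_Ico (ℓ := ℓ) (P.lt_height_of_mem hp)
    rw [ha] at hp hy
    rw [Metric.mem_ball, Real.dist_eq, abs_lt]
    constructor <;> linarith [hp.1, hp.2, hy.1, hy.2]
  have htend := tendsto_measure_iUnion_atTop (μ := volume)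
    (s := fun m => G m ∩ (E ∩ P.space ℓ)) fun a b hab => Set.inter_subset_inter_left _ (hG hab)
  rw [hun] at htend
  filter_upwards [htend.eventually (lt_mem_nhds hOlt)] with m hm
  by_contra! hall
  classical
  let J := (Finset.range (P.height m)).filter fun j => P.lev ℓ m j ⊆ O
  have hGJ : G m = ⋃ j ∈ J, P.lev ℓ m j := by
    ext x
    simp only [G, J, Set.mem_ofPred_eq, Set.mem_iUnion, Finset.mem_filter, Finset.mem_range]
    exact ⟨fun ⟨j, hx, hj⟩ => ⟨j, ⟨P.lt_height_of_mem hx, hj⟩, hx⟩,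
      fun ⟨j, ⟨_, hj⟩, hx⟩ => ⟨j, hx, hj⟩⟩
  have : volume (G m ∩ (E ∩ P.space ℓ)) ≤ c * volume O := by
    calc volume (G m ∩ (E ∩ P.space ℓ))
        = P.measure ℓ (⋃ j ∈ J, P.lev ℓ m j ∩ E) := by
          rw [measure_apply, hGJ, ← Set.inter_assoc, Set.iUnion₂_inter]
      _ ≤ ∑ j ∈ J, P.measure ℓ (P.lev ℓ m j ∩ E) := measure_biUnion_finset_le _ _
      _ ≤ ∑ j ∈ J, c * P.measure ℓ (P.lev ℓ m j) := by
          refine Finset.sum_le_sum fun j hj => ?_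
          have hj : j < P.height m := Finset.mem_range.mp (Finset.mem_filter.mp hj).1
          rw [P.measure_lev hj]
          exact hall j hj
      _ = c * P.measure ℓ (G m) := by
          rw [← Finset.mul_sum, hGJ, measure_biUnion_finset _ fun j _ => P.measurableSet_lev m j]
          intro i _ j _ hij
          exact Set.disjoint_left.mpr fun x hx hx' => hij (P.lev_index_unique hℓ hx hx')
      _ ≤ c * volume O := by
          rw [measure_apply]
          refine mul_le_mul_right (measure_mono ?_) c
          rintro x ⟨⟨j, hx, hj⟩, -⟩
          exact hj hx
  exact absurd hm this.not_gt

lemma eventually_exists_measure_lev_diff_le (hℓ : 0 < ℓ) {E : Set ℝ} (hE : MeasurableSet E)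
    (h0 : P.measure ℓ E ≠ 0) (hfin : P.measure ℓ E ≠ ⊤) {ε : ENNReal} (hε : ε ≠ 0) :
    ∀ᶠ m in Filter.atTop, ∃ j < P.height m,
      P.measure ℓ (P.lev ℓ m j \ E) ≤ ε * ENNReal.ofReal (P.width ℓ m) := by
  have hc : 1 - ε < 1 := ENNReal.sub_lt_self (by simp) (by simp) hε
  filter_upwards [P.eventually_exists_lt_measure_lev_inter hℓ h0 hfin hc] with m ⟨j, hj, h⟩
  refine ⟨j, hj, ?_⟩
  have hfin' : (1 - ε) * ENNReal.ofReal (P.width ℓ m) ≠ ⊤ :=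
    ENNReal.mul_ne_top hc.ne_top ENNReal.ofReal_ne_top
  rw [← ENNReal.add_le_add_iff_left hfin']
  calc _ ≤ P.measure ℓ (P.lev ℓ m j ∩ E) + P.measure ℓ (P.lev ℓ m j \ E) := by gcongr
    _ = ENNReal.ofReal (P.width ℓ m) := by rw [measure_inter_add_sdiff _ hE, P.measure_lev hj]
    _ ≤ _ := by
      rw [← add_mul]
      calc _ = 1 * ENNReal.ofReal (P.width ℓ m) := (one_mul _).symm
        _ ≤ _ := by gcongr; exact le_tsub_add

/-- A point of the `n`-th column that is not regular lies in the top `k` levels of every later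
column, and their total width tends to zero. -/
lemma ae_regular (hℓ : 0 < ℓ) (k : ℕ) : ∀ᵐ x ∂P.measure ℓ, P.Regular ℓ k x := by
  have hnull : ∀ n, P.measure ℓ {x | (∃ i, x ∈ P.lev ℓ n i) ∧ ¬ P.Regular ℓ k x} = 0 := by
    intro n
    have hbound : ∀ m, n ≤ m → P.measure ℓ {x | (∃ i, x ∈ P.lev ℓ n i) ∧ ¬ P.Regular ℓ k x} ≤
        k * ENNReal.ofReal (P.width ℓ m) := by
      intro m hm
      have hsub : {x | (∃ i, x ∈ P.lev ℓ n i) ∧ ¬ P.Regular ℓ k x} ⊆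
          ⋃ j ∈ Finset.Ico (P.height m - k) (P.height m), P.lev ℓ m j := by
        rintro x ⟨⟨i, hi⟩, hx⟩
        obtain ⟨t, p, hp, -⟩ := P.exists_visits_lift hℓ hi hm
        have := P.lt_height_of_mem hp
        have : ¬ p + k < P.height m := fun h => hx ⟨m, p, hp, h⟩
        simp only [Set.mem_iUnion, Finset.mem_Ico]
        exact ⟨p, ⟨by omega, by omega⟩, hp⟩
      calc _ ≤ ∑ j ∈ Finset.Ico (P.height m - k) (P.height m), P.measure ℓ (P.lev ℓ m j) :=
            (measure_mono hsub).trans (measure_biUnion_finset_le _ _)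
        _ = ∑ j ∈ Finset.Ico (P.height m - k) (P.height m), ENNReal.ofReal (P.width ℓ m) :=
            Finset.sum_congr rfl fun j hj => P.measure_lev (Finset.mem_Ico.mp hj).2
        _ ≤ _ := by
            rw [Finset.sum_const, Nat.card_Ico, nsmul_eq_mul]
            gcongr
            omega
    have htend : Filter.Tendsto (fun m => (k : ENNReal) * ENNReal.ofReal (P.width ℓ m))
        Filter.atTop (nhds 0) := by
      have := ENNReal.tendsto_ofReal (P.tendsto_width hℓ)
      rw [ENNReal.ofReal_zero] at this
      simpa using ENNReal.Tendsto.const_mul this (.inr (ENNReal.natCast_ne_top k))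
    exact le_antisymm (ge_of_tendsto htend
      ((Filter.eventually_ge_atTop n).mono hbound)) zero_le
  have hall : ∀ᵐ x ∂P.measure ℓ, ∀ n, ¬ ((∃ i, x ∈ P.lev ℓ n i) ∧ ¬ P.Regular ℓ k x) :=
    ae_all_iff.mpr fun n => by rw [ae_iff]; simpa only [not_not] using hnull n
  filter_upwards [hall, P.ae_mem_space] with x hx hxs
  obtain ⟨n, i, hi⟩ := P.mem_space.mp hxs
  by_contra h
  exact hx n ⟨⟨i, hi⟩, h⟩

/-- The transformation is ergodic. -/
lemma ae_mem_of_invariant (hℓ : 0 < ℓ) {D : Set ℝ} (hD : MeasurableSet D)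
    (hinv : ∀ᵐ x ∂P.measure ℓ, P.transformation ℓ x ∈ D ↔ x ∈ D) (h0 : P.measure ℓ D ≠ 0) :
    ∀ᵐ x ∂P.measure ℓ, x ∈ D := by
  obtain ⟨n, i, hni⟩ : ∃ n i, P.measure ℓ (P.lev ℓ n i ∩ D) ≠ 0 := by
    by_contra! hall
    refine h0 ?_
    rw [measure_apply]
    have : D ∩ P.space ℓ = ⋃ n, ⋃ i, P.lev ℓ n i ∩ D := by
      rw [space_eq, Set.inter_comm]; simp only [Set.iUnion_inter]
    rw [this]
    simpa only [measure_iUnion_null_iff, ← measure_lev_inter] using hall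
  have hfin : P.measure ℓ (P.lev ℓ n i ∩ D) ≠ ⊤ := by
    refine ((measure_mono Set.inter_subset_left).trans_lt ?_).ne
    rcases Set.eq_empty_or_nonempty (P.lev ℓ n i) with h | ⟨x, hx⟩
    · simp [h]
    · rw [P.measure_lev (P.lt_height_of_mem hx)]; exact ENNReal.ofReal_lt_top
  -- One level of a late column is almost filled by `D`; by invariance all its levels are, in the
  -- same proportion, and hence so are the levels of earlier columns.
  have hnull : ∀ n k, k < P.height n → P.measure ℓ (P.lev ℓ n k ∩ Dᶜ) = 0 := by
    intro n' k hk
    refine le_antisymm (le_of_forall_pos_le_add fun δ hδ => ?_) zero_le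
    rw [zero_add]
    have hw := P.width_ne_zero hℓ n'
    have hε : δ / ENNReal.ofReal (P.width ℓ n') ≠ 0 :=
      ENNReal.div_ne_zero.mpr ⟨hδ.ne', ENNReal.ofReal_ne_top⟩
    obtain ⟨m, ⟨j, hj, hle⟩, hm⟩ := ((P.eventually_exists_measure_lev_diff_le hℓ
      ((P.measurableSet_lev n i).inter hD) hni hfin hε).and
      (Filter.eventually_ge_atTop n')).exists
    have hle' : P.measure ℓ (P.lev ℓ m j ∩ Dᶜ) ≤
        δ / ENNReal.ofReal (P.width ℓ n') * ENNReal.ofReal (P.width ℓ m) :=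
      (measure_mono (by rintro x ⟨h1, h2⟩; exact ⟨h1, fun h => h2 h.2⟩)).trans hle
    rw [P.measure_lev_inter_eq_sum hℓ hm hk]
    calc _ ≤ ∑ q ∈ P.occ n' m,
          δ / ENNReal.ofReal (P.width ℓ n') * ENNReal.ofReal (P.width ℓ m) := by
          refine Finset.sum_le_sum fun q hq => ?_
          have := P.occ_add_height_le hq
          rw [P.measure_lev_inter_congr hℓ (F := fun _ => Dᶜ) (fun _ => ?_) (j := j)
            (by omega) hj]
          · exact hle'
          · filter_upwards [hinv] with x hx
            exact not_congr hx
      _ = δ / ENNReal.ofReal (P.width ℓ n') * ENNReal.ofReal (P.width ℓ n') := by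
          rw [Finset.sum_const, nsmul_eq_mul, P.width_eq_card_mul hℓ hm]
          ring
      _ = δ := ENNReal.div_mul_cancel hw ENNReal.ofReal_ne_top
  have hall : ∀ᵐ x ∂P.measure ℓ, ∀ n k, k < P.height n → ¬ (x ∈ P.lev ℓ n k ∧ x ∉ D) := by
    refine ae_all_iff.mpr fun n => ae_all_iff.mpr fun k => ?_
    by_cases hk : k < P.height n
    · have := measure_eq_zero_iff_ae_notMem.mp (hnull n k hk)
      filter_upwards [this] with x hx _ using hx
    · simp [hk]
  filter_upwards [hall, P.ae_mem_space] with x hx hxs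
  obtain ⟨n, i, hi⟩ := P.mem_space.mp hxs
  by_contra h
  exact hx n i (P.lt_height_of_mem hi) ⟨hi, h⟩

end RankOneParams
end

/-! ### Maps commuting with the transformation -/

noncomputable section
namespace RankOneParams

variable {P : RankOneParams} {ℓ : ℝ} {T S : ℝ → ℝ}

lemma ae_iterate_eq (hT : MeasurePreserving T (P.measure ℓ) (P.measure ℓ))
    (hTU : T =ᵐ[P.measure ℓ] P.transformation ℓ) (k : ℕ) :
    ∀ᵐ x ∂P.measure ℓ, T^[k] x = (P.transformation ℓ)^[k] x := by
  induction k with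
  | zero => simp
  | succ k ih =>
    filter_upwards [hTU, hT.quasiMeasurePreserving.ae ih] with x hx hk
    rw [Function.iterate_succ_apply, Function.iterate_succ_apply, hk, hx]

lemma Regular.visits_iterate (hℓ : 0 < ℓ) {k : ℕ} {x : ℝ} (h : P.Regular ℓ k x) (n : ℕ) (e : ℤ) :
    P.Visits ℓ n ((P.transformation ℓ)^[k] x) e ↔ P.Visits ℓ n x (e + k) := by
  induction k generalizing x e with
  | zero => simp
  | succ k ih =>
    obtain ⟨m, p, hx, hp⟩ := h
    have h1 : P.Regular ℓ 1 x := ⟨m, p, hx, by omega⟩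
    have h2 : P.Regular ℓ k (P.transformation ℓ x) :=
      ⟨m, p + 1, P.transformation_mem_lev hℓ (by omega) hx, by omega⟩
    rw [Function.iterate_succ_apply, ih h2, h1.visits_transformation hℓ]
    push_cast
    rw [add_assoc]

variable (P ℓ) in
/-- `T` is a version of the transformation, and `S` a measure-preserving map that commutes
with it. -/
structure Commuting (T S : ℝ → ℝ) : Prop where
  left : MeasurePreserving T (P.measure ℓ) (P.measure ℓ)
  right : MeasurePreserving S (P.measure ℓ) (P.measure ℓ)
  ae_eq : T =ᵐ[P.measure ℓ] P.transformation ℓ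
  comm : S ∘ T =ᵐ[P.measure ℓ] T ∘ S

lemma Commuting.ae_transformation (h : P.Commuting ℓ T S) :
    ∀ᵐ x ∂P.measure ℓ, S (P.transformation ℓ x) = P.transformation ℓ (S x) := by
  filter_upwards [h.ae_eq, h.comm, h.right.quasiMeasurePreserving.ae h.ae_eq] with x h1 h2 h3
  rw [← h1, ← h3]; exact h2

lemma Commuting.ae_near_iff (hℓ : 0 < ℓ) (h : P.Commuting ℓ T S) (n : ℕ) (e : ℤ) :
    ∀ᵐ x ∂P.measure ℓ, P.Near ℓ n (P.transformation ℓ x) (S (P.transformation ℓ x)) e ↔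
      P.Near ℓ n x (S x) (e + 1) := by
  filter_upwards [h.ae_transformation, P.ae_regular hℓ 1,
    h.right.quasiMeasurePreserving.ae (P.ae_regular hℓ 1)] with x h1 h2 h3
  rw [h1, Near, Near, h2.visits_transformation hℓ]
  simp only [h3.visits_transformation hℓ, add_right_comm e _ 1]

/-- The density argument is applied to the preimage under `S` of the base of the column of stage
`0`. It yields a single good level `j`, and commutation makes the bad proportion the same in all
levels. -/
lemma Commuting.eventually_measure_not_near_le (hℓ : 0 < ℓ) (h : P.Commuting ℓ T S) {ε : ENNReal}
    (hε : ε ≠ 0) : ∀ᶠ m in Filter.atTop, ∀ i < P.height m,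
      P.measure ℓ (P.lev ℓ m i ∩ {x | ¬ P.Near ℓ m x (S x) (-i)}) ≤
        ε * ENNReal.ofReal (P.width ℓ m) := by
  have hE : P.measure ℓ (S ⁻¹' P.lev ℓ 0 0) = ENNReal.ofReal (P.width ℓ 0) := by
    rw [h.right.measure_preimage (P.measurableSet_lev 0 0).nullMeasurableSet,
      P.measure_lev (P.height_pos 0)]
  filter_upwards [P.eventually_exists_measure_lev_diff_le hℓ
    (h.right.measurable (P.measurableSet_lev 0 0)) (hE ▸ P.width_ne_zero hℓ 0)
    (hE ▸ ENNReal.ofReal_ne_top) hε] with m ⟨j, hj, hle⟩ i hi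
  rw [P.measure_lev_inter_congr hℓ (F := fun e => {x | ¬ P.Near ℓ m x (S x) e}) (j := j)
    (fun e => ?_) hi hj]
  · refine (measure_mono ?_).trans hle
    rintro x ⟨hx, hn⟩
    refine ⟨hx, fun hS => hn ⟨P.visits_neg_of_mem_lev hx, ?_⟩⟩
    -- Both `x` and `S x` now lie in the `m`-th column, at levels `j` and `p`, so their passages are
    -- displaced by `j - p`.
    obtain ⟨t, p, hp, -⟩ := P.exists_visits_lift hℓ hS (Nat.zero_le m)
    have hpm := P.lt_height_of_mem hp
    refine ⟨j - p, by rw [abs_lt]; constructor <;> omega, ?_⟩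
    have := P.visits_neg_of_mem_lev hp
    rwa [show -(j : ℤ) + (j - p) = -p by ring]
  · filter_upwards [h.ae_near_iff hℓ m e] with x hx using not_congr hx

variable (P ℓ S) in
open Classical in
/-- During the passage of `x`, at the level `i`, through the `m`-th column, `S x` has a close
passage through this column, and so it is for most visits to the base of the `n`-th column. -/
def MostlyNear (R n m i : ℕ) (x : ℝ) : Prop :=
  P.Near ℓ m x (S x) (-i) ∧
    ((P.occ n m).filter fun q : ℕ => ¬ P.Near ℓ n x (S x) (-i + q)).card * R < (P.occ n m).card

/-- Moved from level `i` to the levels `q`, the bad sets `Q q` add up to the bad part of the base of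
the `n`-th column. Markov's inequality then contributes `R * ε`, and failure of nearness at stage
`m` contributes one more `ε`. -/
lemma Commuting.measure_not_mostlyNear_le (hℓ : 0 < ℓ) (h : P.Commuting ℓ T S) {ε : ENNReal}
    {R n m i : ℕ} (hnm : n ≤ m) (hi : i < P.height m)
    (hn : P.measure ℓ (P.lev ℓ n 0 ∩ {x | ¬ P.Near ℓ n x (S x) 0}) ≤
      ε * ENNReal.ofReal (P.width ℓ n))
    (hm : P.measure ℓ (P.lev ℓ m i ∩ {x | ¬ P.Near ℓ m x (S x) (-i)}) ≤
      ε * ENNReal.ofReal (P.width ℓ m)) :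
    P.measure ℓ (P.lev ℓ m i ∩ {x | ¬ P.MostlyNear ℓ S R n m i x}) ≤
      (R + 1) * ε * ENNReal.ofReal (P.width ℓ m) := by
  classical
  set K := (P.occ n m).card with hK
  have hK0 : (K : ENNReal) ≠ 0 := by
    rw [Nat.cast_ne_zero, hK, Finset.card_ne_zero]
    exact ⟨0, P.zero_mem_occ hnm⟩
  let Q : ℕ → Set ℝ := fun q => P.lev ℓ m i ∩ {x | ¬ P.Near ℓ n x (S x) (-i + q)}
  have hQ : ∑ q ∈ P.occ n m, P.measure ℓ (Q q) ≤ ε * (K * ENNReal.ofReal (P.width ℓ m)) := by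
    rw [← P.width_eq_card_mul hℓ hnm]
    refine le_trans (le_of_eq ?_) hn
    rw [P.measure_lev_inter_eq_sum hℓ hnm (P.height_pos n)]
    refine Finset.sum_congr rfl fun q hq => ?_
    have := P.measure_lev_inter_congr hℓ
      (F := fun e => {x | ¬ P.Near ℓ n x (S x) (e + q)}) (fun e => ?_) hi
      (P.lt_height_of_mem_occ hq)
    · simpa [Q] using this
    · filter_upwards [h.ae_near_iff hℓ n (e + q)] with x hx
      rw [add_right_comm] at hx
      exact not_congr hx
  have hcount : P.measure ℓ {x | K ≤ ((P.occ n m).filter fun q => x ∈ Q q).card * R} ≤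
      R * ε * ENNReal.ofReal (P.width ℓ m) := by
    have := (mul_measure_le_card_filter_mul (P.measure ℓ) (P.occ n m) Q K R).trans
      (mul_le_mul_right hQ R)
    rw [← ENNReal.mul_le_mul_iff_right hK0 (ENNReal.natCast_ne_top K)]
    exact this.trans_eq (by ring)
  calc _ ≤ P.measure ℓ ((P.lev ℓ m i ∩ {x | ¬ P.Near ℓ m x (S x) (-i)}) ∪
        {x | K ≤ ((P.occ n m).filter fun q => x ∈ Q q).card * R}) := by
        refine measure_mono ?_
        rintro x ⟨hx, hb⟩
        by_cases hnear : P.Near ℓ m x (S x) (-i)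
        · right
          have : ¬ _ := fun h => hb ⟨hnear, h⟩
          rw [not_lt] at this
          simpa [Q, hx, K] using this
        · exact .inl ⟨hx, hnear⟩
    _ ≤ ε * ENNReal.ofReal (P.width ℓ m) + R * ε * ENNReal.ofReal (P.width ℓ m) :=
        (measure_union_le _ _).trans (add_le_add hm hcount)
    _ = _ := by ring

/-- There is a stage such that with positive probability, in infinitely many columns, the
passages of `x` and `S x` are separated by less than the height of the column of this stage. -/
lemma Commuting.exists_frequently_visits (hℓ : 0 < ℓ) {N R : ℕ} (hP : P.WideGaps N R)
    (h : P.Commuting ℓ T S) : ∃ n, P.measure ℓ {x | ∃ᶠ m in Filter.atTop,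
      ∃ d ∈ Set.Ioo (-P.height n : ℤ) (P.height n), ∃ i, x ∈ P.lev ℓ m i ∧
        P.Visits ℓ m (S x) (-i + d)} ≠ 0 := by
  have hR0 : (2 * ((R : ENNReal) + 1)) ≠ 0 := by simp
  have hRt : (2 * ((R : ENNReal) + 1)) ≠ ⊤ := by finiteness
  obtain ⟨n₀, hn₀⟩ := Filter.eventually_atTop.mp
    (h.eventually_measure_not_near_le hℓ (ENNReal.inv_ne_zero.mpr hRt))
  set n := max n₀ N with hn
  have hnN : N ≤ n := le_max_right _ _
  refine ⟨n, fun hzero => ?_⟩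
  set w := ENNReal.ofReal (P.width ℓ n) with hw
  -- The choice of `ε` leaves at most half of the base of the `n`-th column bad, at each stage `m`.
  have hhalf : ((R : ENNReal) + 1) * (2 * ((R : ENNReal) + 1))⁻¹ = 2⁻¹ := by
    rw [ENNReal.mul_inv (by simp) (by simp), mul_left_comm, ENNReal.mul_inv_cancel (by simp)
      (by finiteness), mul_one]
  let B : ℕ → Set ℝ := fun m => {x | x ∈ P.lev ℓ n 0 ∧
    ∃ i, x ∈ P.lev ℓ m i ∧ ¬ P.MostlyNear ℓ S R n m i x}
  have hB : ∀ m, n ≤ m → P.measure ℓ (B m) ≤ 2⁻¹ * w := by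
    intro m hm
    have hBeq : B m = P.lev ℓ n 0 ∩ B m := by
      ext x; simp only [B, Set.mem_inter_iff, Set.mem_ofPred_eq]; tauto
    rw [hBeq, P.measure_lev_inter_eq_sum hℓ hm (P.height_pos n), hw, P.width_eq_card_mul hℓ hm,
      mul_left_comm, ← nsmul_eq_mul, ← Finset.sum_const]
    refine Finset.sum_le_sum fun q hq => ?_
    have hqm := P.lt_height_of_mem_occ hq
    rw [← hhalf]
    refine (measure_mono ?_).trans (h.measure_not_mostlyNear_le (R := R) hℓ hm hqm
      (by simpa using hn₀ n (le_max_left _ _) 0 (P.height_pos n))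
      (hn₀ m (le_trans (le_max_left _ _) hm) q hqm))
    rintro x ⟨hx, -, i, hxi, hi⟩
    obtain rfl := P.lev_index_unique hℓ hx hxi
    exact ⟨hx, hi⟩
  -- Points that are bad from some stage on still make up at most half of the base; all others are
  -- good infinitely often.
  have hlim : P.measure ℓ (⋃ k, ⋂ m ≥ k, B m) ≤ 2⁻¹ * w := by
    have hmono : Monotone fun k => ⋂ m ≥ k, B m := fun a b hab =>
      Set.biInter_subset_biInter_left fun m hm => le_trans hab hm
    rw [hmono.measure_iUnion]
    refine iSup_le fun k => (measure_mono (Set.iInter₂_subset (max k n) (le_max_left _ _))).trans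
      (hB _ (le_max_right _ _))
  have hsub : P.lev ℓ n 0 ⊆ (⋃ k, ⋂ m ≥ k, B m) ∪ {x | ∃ᶠ m in Filter.atTop,
      ∃ d ∈ Set.Ioo (-P.height n : ℤ) (P.height n), ∃ i, x ∈ P.lev ℓ m i ∧
        P.Visits ℓ m (S x) (-i + d)} := by
    intro x hx
    by_cases hxB : x ∈ ⋃ k, ⋂ m ≥ k, B m
    · exact .inl hxB
    right
    simp only [Set.mem_iUnion, Set.mem_iInter, not_exists, not_forall] at hxB
    refine Filter.frequently_atTop.mpr fun k => ?_
    obtain ⟨m, hm, hmB⟩ := hxB (max k n)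
    have hnm : n ≤ m := le_trans (le_max_right _ _) hm
    refine ⟨m, le_trans (le_max_left _ _) hm, ?_⟩
    obtain ⟨t, i, hi, -⟩ := P.exists_visits_lift hℓ hx hnm
    have hmost : P.MostlyNear ℓ S R n m i x := by
      by_contra hc
      exact hmB ⟨hx, i, hi, hc⟩
    obtain ⟨⟨hv, d, hd, hd'⟩, hcount⟩ := hmost
    have := hP.abs_lt_of_near hℓ hnN hnm hd hv hd' (by convert hcount)
    exact ⟨d, ⟨by linarith [(abs_lt.mp this).1], (abs_lt.mp this).2⟩, i, hi, hd'⟩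
  have : w ≤ 2⁻¹ * w := by
    calc w = P.measure ℓ (P.lev ℓ n 0) := (P.measure_lev (P.height_pos n)).symm
      _ ≤ _ := (measure_mono hsub).trans (measure_union_le _ _)
      _ ≤ 2⁻¹ * w := by rw [hzero, add_zero]; exact hlim
  refine absurd this (not_le.mpr ?_)
  rw [mul_comm, ← div_eq_mul_inv]
  exact ENNReal.half_lt_self (P.width_ne_zero hℓ n) ENNReal.ofReal_ne_top

/-- When `x` is at level `i`, both iterates are at level `i + b` of the same column, for infinitely
many columns. -/
lemma iterate_eq_of_frequently_visits (hℓ : 0 < ℓ) {x y : ℝ} {a b : ℕ} (hx : P.Regular ℓ b x)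
    (hy : P.Regular ℓ a y) (h : ∃ᶠ m in Filter.atTop, ∃ i, x ∈ P.lev ℓ m i ∧
      P.Visits ℓ m y (-i + (a - b))) :
    (P.transformation ℓ)^[a] y = (P.transformation ℓ)^[b] x := by
  obtain ⟨m₀, hm₀⟩ := hx.lift hℓ
  refine P.eq_of_frequently_mem_lev hℓ
    ((h.and_eventually (Filter.eventually_ge_atTop m₀)).mono ?_)
  rintro m ⟨⟨i, hi, hv⟩, hm⟩
  obtain ⟨p, hp, hpb⟩ := hm₀ m hm
  obtain rfl := P.lev_index_unique hℓ hi hp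
  refine ⟨i + b, P.mem_lev_of_visits_neg hℓ hpb ?_, P.mem_lev_of_visits_neg hℓ hpb ?_⟩
  · rw [hy.visits_iterate hℓ]
    convert hv using 1
    push_cast; ring
  · rw [hx.visits_iterate hℓ]
    convert P.visits_neg_of_mem_lev hi using 1
    push_cast; ring

lemma Commuting.exists_measure_ne_zero (hℓ : 0 < ℓ) {N R : ℕ} (hP : P.WideGaps N R)
    (h : P.Commuting ℓ T S) :
    ∃ d : ℤ, P.measure ℓ {x | T^[d.toNat] (S x) = T^[(-d).toNat] x} ≠ 0 := by
  obtain ⟨n, hn⟩ := h.exists_frequently_visits hℓ hP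
  by_contra! hall
  refine hn ?_
  have hall' : ∀ᵐ x ∂P.measure ℓ, ∀ d : ℤ, ¬ T^[d.toNat] (S x) = T^[(-d).toNat] x :=
    ae_all_iff.mpr fun d => measure_eq_zero_iff_ae_notMem.mp (hall d)
  have hit := ae_all_iff.mpr (ae_iterate_eq h.left h.ae_eq)
  have hreg := ae_all_iff.mpr (P.ae_regular hℓ)
  refine measure_eq_zero_iff_ae_notMem.mpr ?_
  filter_upwards [hall', hit, h.right.quasiMeasurePreserving.ae hit, hreg,
    h.right.quasiMeasurePreserving.ae hreg] with x hx hx1 hx2 hx3 hx4 hfreq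
  -- Pigeonhole: finitely many displacements are allowed, so one recurs infinitely often.
  obtain ⟨d, -, hd⟩ := (Filter.frequently_exists_finite (Set.finite_Ioo _ _)).mp hfreq
  refine hx d ?_
  rw [hx1, hx2]
  refine iterate_eq_of_frequently_visits hℓ (hx3 _) (hx4 _) (hd.mono ?_)
  rintro m ⟨i, hi, hv⟩
  refine ⟨i, hi, ?_⟩
  convert hv using 2
  omega

lemma ae_injOn (hℓ : 0 < ℓ) (hTU : T =ᵐ[P.measure ℓ] P.transformation ℓ) :
    ∃ Z, MeasurableSet Z ∧ (∀ᵐ x ∂P.measure ℓ, x ∈ Z) ∧ Set.InjOn T Z := by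
  have hae : ∀ᵐ x ∂P.measure ℓ, T x = P.transformation ℓ x ∧ P.Regular ℓ 1 x :=
    hTU.and (P.ae_regular hℓ 1)
  obtain ⟨Z, hZ, hZm, hZs⟩ := exists_measurable_superset_of_null (ae_iff.mp hae)
  refine ⟨Zᶜ, hZm.compl, measure_eq_zero_iff_ae_notMem.mp hZs, fun x hx y hy hxy => ?_⟩
  obtain ⟨hx1, hx2⟩ : T x = P.transformation ℓ x ∧ P.Regular ℓ 1 x := by
    by_contra hc; exact hx (hZ hc)
  obtain ⟨hy1, hy2⟩ : T y = P.transformation ℓ y ∧ P.Regular ℓ 1 y := by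
    by_contra hc; exact hy (hZ hc)
  exact hx2.transformation_injective hℓ hy2 (by rw [← hx1, ← hy1, hxy])

/-- Measure-preserving maps that commute with the transformation are powers of it. -/
theorem Commuting.isPowerAE (hℓ : 0 < ℓ) {N R : ℕ} (hP : P.WideGaps N R)
    (h : P.Commuting ℓ T S) : IsPowerAE (P.measure ℓ) T S := by
  obtain ⟨d, hd⟩ := h.exists_measure_ne_zero hℓ hP
  have hcomm : ∀ k, ∀ᵐ x ∂P.measure ℓ, S (T^[k] x) = T^[k] (S x) := by
    intro k
    induction k with
    | zero => simp
    | succ k ih =>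
      filter_upwards [h.comm, h.left.quasiMeasurePreserving.ae ih] with x h1 h2
      rw [Function.iterate_succ_apply, h2, Function.iterate_succ_apply]
      exact congrArg _ h1
  obtain ⟨Z, -, hZ, hinj⟩ := ae_injOn hℓ h.ae_eq
  have key : ∀ᵐ x ∂P.measure ℓ, x ∈ {x | T^[d.toNat] (S x) = T^[(-d).toNat] x} := by
    refine P.ae_mem_of_invariant hℓ ?_ ?_ hd
    · exact measurableSet_eq_fun ((h.left.iterate _).measurable.comp h.right.measurable)
        (h.left.iterate _).measurable
    · filter_upwards [h.ae_eq, h.comm,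
        h.right.quasiMeasurePreserving.ae ((h.left.iterate d.toNat).quasiMeasurePreserving.ae hZ),
        (h.left.iterate (-d).toNat).quasiMeasurePreserving.ae hZ] with x h1 h2 h3 h4
      have h2 : S (T x) = T (S x) := h2
      rw [← h1, h2, ← Function.iterate_succ_apply,
        ← Function.iterate_succ_apply, Function.iterate_succ_apply', Function.iterate_succ_apply']
      -- Invariance in both directions requires cancelling `T`, hence its essential injectivity.
      exact hinj.eq_iff h3 h4
  rcases le_total d 0 with hd0 | hd0
  · refine .inl ⟨(-d).toNat, ?_⟩
    filter_upwards [key] with x hx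
    have : d.toNat = 0 := by omega
    simpa [this] using hx
  · have h0 : (-d).toNat = 0 := by omega
    have h1 : T^[d.toNat] ∘ S =ᵐ[P.measure ℓ] id := by
      filter_upwards [key] with x hx
      simpa [h0] using hx
    refine .inr ⟨d.toNat, h1, ?_⟩
    filter_upwards [h1, hcomm d.toNat] with x hx hx'
    exact hx'.trans hx

end RankOneParams
end

noncomputable section

/-! ### Inverses, and powers as members of the centralizer -/

section Inverse

variable {X : Type*} [MeasurableSpace X] {μ : Measure X} {T S R : X → X}

lemma measurePreserving_of_comp_ae_eq_id (hT : MeasurePreserving T μ μ) (hR : Measurable R)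
    (h : R ∘ T =ᵐ[μ] id) : MeasurePreserving R μ μ := by
  refine ⟨hR, ?_⟩
  conv_lhs => rw [← hT.map_eq]
  rw [Measure.map_map hR hT.measurable, Measure.map_congr h, Measure.map_id]

lemma iterate_comp_iterate_ae_eq_id (hT : MeasurePreserving T μ μ) (h : R ∘ T =ᵐ[μ] id) (m : ℕ) :
    R^[m] ∘ T^[m] =ᵐ[μ] id := by
  induction m with
  | zero => rfl
  | succ m ih =>
    filter_upwards [ih, (hT.iterate m).quasiMeasurePreserving.ae h] with x h1 h2
    have h2 : R (T (T^[m] x)) = T^[m] x := h2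
    rw [Function.comp_apply, Function.iterate_succ_apply' T, Function.iterate_succ_apply R, h2]
    exact h1

/-- A measure-preserving map of a standard Borel space that is essentially injective has a
measure-preserving inverse. -/
lemma exists_measurePreserving_inverse [StandardBorelSpace X] [Nonempty X]
    (hT : MeasurePreserving T μ μ) {Z : Set X} (hZ : MeasurableSet Z) (hμ : ∀ᵐ x ∂μ, x ∈ Z)
    (hinj : Set.InjOn T Z) :
    ∃ R : X → X, MeasurePreserving R μ μ ∧ R ∘ T =ᵐ[μ] id ∧ T ∘ R =ᵐ[μ] id := by
  have : StandardBorelSpace Z := hZ.standardBorel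
  obtain ⟨R, hR, hRT⟩ := ((hT.measurable.comp measurable_subtype_coe).measurableEmbedding
    (Set.injOn_iff_injective.mp hinj)).exists_measurable_extend measurable_subtype_coe fun _ => inferInstance
  have hRT' : ∀ x ∈ Z, R (T x) = x := fun x hx => congrFun hRT ⟨x, hx⟩
  have h1 : R ∘ T =ᵐ[μ] id := hμ.mono hRT'
  refine ⟨R, measurePreserving_of_comp_ae_eq_id hT hR h1, h1, ?_⟩
  have hTZ : MeasurableSet (T '' Z) := hZ.image_of_measurable_injOn hT.measurable hinj
  -- The preimage of this complement misses the conull set `Z`, so `T` is essentially onto.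
  have h0 : μ (T '' Z)ᶜ = 0 := by
    rw [← hT.measure_preimage hTZ.compl.nullMeasurableSet]
    exact measure_mono_null (fun x hx hxZ => hx ⟨x, hxZ, rfl⟩) hμ
  filter_upwards [measure_eq_zero_iff_ae_notMem.mp h0] with y hy
  obtain ⟨x, hx, rfl⟩ := not_not.mp hy
  exact congrArg T (hRT' x hx)

/-- The integer powers of an invertible measure-preserving transformation belong to its
centralizer. -/
lemma mem_transformationCentralizer_of_isPowerAE (hT : IsInvertibleMeasurePreserving μ T)
    (hS : Measurable S) (h : IsPowerAE μ T S) : S ∈ transformationCentralizer μ T := by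
  obtain ⟨hT, R, hR, hRT, hTR⟩ := hT
  rcases h with ⟨m, hm⟩ | ⟨m, h1, h2⟩
  · have hSm : MeasurePreserving S μ μ :=
      ⟨hS, by rw [Measure.map_congr hm, (hT.iterate m).map_eq]⟩
    refine ⟨⟨hSm, R^[m], hR.iterate m, ?_, ?_⟩, ?_⟩
    · filter_upwards [hm, iterate_comp_iterate_ae_eq_id hT hRT m] with x hx hx'
      rw [Function.comp_apply, hx]; exact hx'
    · filter_upwards [(hR.iterate m).quasiMeasurePreserving.ae hm,
        iterate_comp_iterate_ae_eq_id hR hTR m] with x hx hx'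
      rw [Function.comp_apply, hx]; exact hx'
    · filter_upwards [hm, hT.quasiMeasurePreserving.ae hm] with x hx hx'
      rw [Function.comp_apply, Function.comp_apply, hx, hx', ← Function.iterate_succ_apply,
        Function.iterate_succ_apply']
  · have hSm := measurePreserving_of_comp_ae_eq_id (hT.iterate m) hS h2
    refine ⟨⟨hSm, T^[m], hT.iterate m, h1, h2⟩, ?_⟩
    filter_upwards [h1, (hT.comp hSm).quasiMeasurePreserving.ae h2] with x hx hx'
    have hx : T^[m] (S x) = x := hx
    have hx' : S (T^[m] (T (S x))) = T (S x) := hx'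
    rw [Function.comp_apply, Function.comp_apply, ← hx', ← Function.iterate_succ_apply,
      Function.iterate_succ_apply', hx]

end Inverse

/-! ### Transfer along an isomorphism of systems -/

section Transfer

variable {X Y : Type*} [MeasurableSpace X] {μ : Measure X} {T S : X → X} {T' S' : Y → Y}
  {φ : X → Y} {ψ : Y → X}

lemma ae_iterate_intertwine (hT : MeasurePreserving T μ μ) (h : φ ∘ T =ᵐ[μ] T' ∘ φ) (m : ℕ) :
    φ ∘ T^[m] =ᵐ[μ] T'^[m] ∘ φ := by
  induction m with
  | zero => rfl
  | succ m ih =>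
    filter_upwards [h, hT.quasiMeasurePreserving.ae ih] with x h1 h2
    have h1 : φ (T x) = T' (φ x) := h1
    have h2 : φ (T^[m] (T x)) = T'^[m] (φ (T x)) := h2
    rw [Function.comp_apply, Function.comp_apply, Function.iterate_succ_apply, h2, h1,
      Function.iterate_succ_apply]

variable [MeasurableSpace Y] {ν : Measure Y}

lemma IsPowerAE.of_intertwine (hT : MeasurePreserving T μ μ) (hS : MeasurePreserving S μ μ)
    (hφ : MeasurePreserving φ μ ν) (hψφ : ψ ∘ φ =ᵐ[μ] id) (hTT : φ ∘ T =ᵐ[μ] T' ∘ φ)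
    (hSS : φ ∘ S =ᵐ[μ] S' ∘ φ) (h : IsPowerAE ν T' S') : IsPowerAE μ T S := by
  have inj : ∀ {u v : X}, ψ (φ u) = u → ψ (φ v) = v → φ u = φ v → u = v :=
    fun hu hv huv => by rw [← hu, ← hv, huv]
  rcases h with ⟨m, hm⟩ | ⟨m, h1, h2⟩
  · refine .inl ⟨m, ?_⟩
    filter_upwards [hS.quasiMeasurePreserving.ae hψφ,
      (hT.iterate m).quasiMeasurePreserving.ae hψφ, hSS, ae_iterate_intertwine hT hTT m,
      hφ.quasiMeasurePreserving.ae hm] with x a b c d e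
    exact inj a b (c.trans (e.trans d.symm))
  · have hTm := ae_iterate_intertwine hT hTT m
    refine .inr ⟨m, ?_, ?_⟩
    · filter_upwards [((hT.iterate m).comp hS).quasiMeasurePreserving.ae hψφ, hψφ, hSS,
        hS.quasiMeasurePreserving.ae hTm, hφ.quasiMeasurePreserving.ae h1] with x a b c d e
      refine inj a b (d.trans (Eq.trans ?_ e))
      exact congrArg T'^[m] c
    · filter_upwards [(hS.comp (hT.iterate m)).quasiMeasurePreserving.ae hψφ, hψφ, hTm,
        (hT.iterate m).quasiMeasurePreserving.ae hSS,
        hφ.quasiMeasurePreserving.ae h2] with x a b c d e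
      refine inj a b (d.trans (Eq.trans ?_ e))
      exact congrArg S' c

lemma IsInvertibleMeasurePreserving.of_intertwine (hT : MeasurePreserving T μ μ)
    (hφ : MeasurePreserving φ μ ν) (hψ : MeasurePreserving ψ ν μ) (hψφ : ψ ∘ φ =ᵐ[μ] id)
    (hφψ : φ ∘ ψ =ᵐ[ν] id) (hTT : φ ∘ T =ᵐ[μ] T' ∘ φ) (h : IsInvertibleMeasurePreserving ν T') :
    IsInvertibleMeasurePreserving μ T := by
  obtain ⟨-, R, hR, hRT, hTR⟩ := h
  have hRφ := hR.comp hφ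
  have hR' := hψ.comp hRφ
  refine ⟨hT, ψ ∘ R ∘ φ, hR', ?_, ?_⟩
  · filter_upwards [hTT, hφ.quasiMeasurePreserving.ae hRT, hψφ] with x a b c
    have a : φ (T x) = T' (φ x) := a
    have b : R (T' (φ x)) = φ x := b
    change ψ (R (φ (T x))) = x
    rw [a, b]; exact c
  · filter_upwards [(hT.comp hR').quasiMeasurePreserving.ae hψφ, hψφ,
      hR'.quasiMeasurePreserving.ae hTT, hRφ.quasiMeasurePreserving.ae hφψ,
      hφ.quasiMeasurePreserving.ae hTR] with x a b c d e
    have a : ψ (φ (T (ψ (R (φ x))))) = T (ψ (R (φ x))) := a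
    have b : ψ (φ x) = x := b
    have c : φ (T (ψ (R (φ x)))) = T' (φ (ψ (R (φ x)))) := c
    have d : φ (ψ (R (φ x))) = R (φ x) := d
    have e : T' (R (φ x)) = φ x := e
    change T (ψ (R (φ x))) = x
    rw [← a, c, d, e, b]

end Transfer

lemma RankOneParams.PartiallyBounded.exists_wideGaps {P : RankOneParams}
    (h : P.PartiallyBounded) : ∃ N R, P.WideGaps N R := by
  obtain ⟨hs, R, _, N, -, -, h⟩ := h
  exact ⟨N, R, hs, fun n hn => (h n hn).1, fun n hn i hi => by
    rw [← P.length_word hs]; exact (h n hn).2.2 i hi⟩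
end
theorem theorem5p1 {X : Type*} [MeasurableSpace X] (μ : Measure X) (T : X → X)
    (hT : IsPartiallyBoundedRankOne μ T) :
    (∀ S : X → X, MeasurePreserving S μ μ → S ∘ T =ᵐ[μ] T ∘ S → IsPowerAE μ T S) ∧
      HasTrivialCentralizer μ T := by
  obtain ⟨hTm, ℓ, P, hℓ, hP, φ, ψ, hφ, hψ, hψφ, hφψ, hTU⟩ := hT
  obtain ⟨N, R, hP⟩ := hP.exists_wideGaps
  have hconj : ∀ {S : X → X}, MeasurePreserving S μ μ →
      MeasurePreserving (φ ∘ S ∘ ψ) (P.measure ℓ) (P.measure ℓ) := fun hS => hφ.comp (hS.comp hψ)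
  have hinter : ∀ S : X → X, φ ∘ S =ᵐ[μ] (φ ∘ S ∘ ψ) ∘ φ := fun S => by
    filter_upwards [hψφ] with x hx
    exact congrArg (φ ∘ S) hx.symm
  have hTae : φ ∘ T ∘ ψ =ᵐ[P.measure ℓ] P.transformation ℓ := by
    filter_upwards [hψ.quasiMeasurePreserving.ae hTU, hφψ] with y hy hy'
    exact hy.trans (congrArg _ hy')
  -- Both maps are conjugated to the line; the conjugate of `T` agrees only a.e. with the concrete
  -- transformation, as `Commuting` allows.
  have main : ∀ S : X → X, MeasurePreserving S μ μ → S ∘ T =ᵐ[μ] T ∘ S → IsPowerAE μ T S := by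
    intro S hS hST
    refine IsPowerAE.of_intertwine hTm hS hφ hψφ (hinter T) (hinter S)
      (RankOneParams.Commuting.isPowerAE hℓ hP ⟨hconj hTm, hconj hS, hTae, ?_⟩)
    filter_upwards [hψ.quasiMeasurePreserving.ae hST,
      (hTm.comp hψ).quasiMeasurePreserving.ae hψφ,
      (hS.comp hψ).quasiMeasurePreserving.ae hψφ] with y a b c
    exact (congrArg (φ ∘ S) b).trans ((congrArg φ a).trans (congrArg (φ ∘ T) c).symm)
  refine ⟨main, Set.ext fun S => ⟨fun hS => ⟨hS.1.1.measurable, main S hS.1.1 hS.2⟩,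
    fun hS => mem_transformationCentralizer_of_isPowerAE ?_ hS.1 hS.2⟩⟩
  -- The inverse of `T` is built on the line, a standard Borel space, and pulled back, since `X` is
  -- arbitrary.
  obtain ⟨Z, hZ, hae, hinj⟩ := RankOneParams.ae_injOn hℓ hTae
  exact IsInvertibleMeasurePreserving.of_intertwine hTm hφ hψ hψφ hφψ (hinter T)
    ⟨hconj hTm, exists_measurePreserving_inverse (hconj hTm) hZ hae hinj⟩
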